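/- **Setting.** Consider a sequence of problems, indexed by $k\in\mathbb N$, with sample sizes $n=n_k\to\infty$, $p=p_k\to\infty$ predictors and $r=r_k\to\infty$ responses. In each of them $\mathbf Y=\boldsymbol\alpha+\boldsymbol\beta\mathbf X+\boldsymbol\varepsilon$ with $\mathbf X\in\mathbb R^p$, $\mathbf Y\in\mathbb R^r$, $\boldsymbol\varepsilon$ independent of $\mathbf X$, and there is a constant $\sigma>0$, the same for all $k$, such that $P(|\mathbf w^{T}(\mathbf X^T,\mathbf Y^T)^T|\ge t)\le 2\exp(-t^2/\sigma^2)$ for all unit vectors $\mathbf w\in\mathbb R^{p+r}$ and all $t\ge 0$. One observes $n$ i.i.d. copies of $(\mathbf X,\mathbf Y)$. Let $\mathbf M=\boldsymbol\Sigma_{\mathbf Y}=\mathrm{cov}(\mathbf Y)$, $\boldsymbol\Sigma_{\mathbf{XY}}=\mathrm{cov}(\mathbf X,\mathbf Y)=\boldsymbol\Sigma_{\mathbf{YX}}^T$ and $\mathbf U=\boldsymbol\Sigma_{\mathbf{YX}}\boldsymbol\Sigma_{\mathbf{XY}}$. A subspace $\mathcal R$ of $\mathbb R^r$ reduces $\mathbf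 M$ if $\mathbf M=\mathbf P_{\mathcal R}\mathbf M\mathbf P_{\mathcal R}+\mathbf Q_{\mathcal R}\mathbf M\mathbf Q_{\mathcal R}$, where $\mathbf P_{\mathcal R}$ is the orthogonal projection onto $\mathcal R$ and $\mathbf Q_{\mathcal R}=\mathbf I-\mathbf P_{\mathcal R}$. The response envelope $\mathcal E=\mathcal E_{\mathbf M}(\mathbf U)$ is the intersection of all reducing subspaces of $\mathbf M$ that contain $\mathrm{span}(\mathbf U)$; let $u=\dim\mathcal E\ge 1$, which is known. With eigenvalues $\lambda_1(\mathbf M)\ge\lambda_2(\mathbf M)\ge\cdots$ (and $\lambda_{r+1}(\mathbf M):=0$) assume, for a fixed number $d$ and a constant $\Delta>0$ that do not depend on $k$, that $\lambda_j(\mathbf M)-\lambda_{j+1}(\mathbf M)\ge\Delta$ for $j=1,\dots,d$ and that $\mathcal E$ is contained in the span of the first $d$ orthonormal eigenvectors $\mathbf v_1,\dots,\mathbf v_d$ of $\mathbf M$. Let $\phi_{(1)}\ge\cdots\ge\phi_{(d)}$ be the numbers $\phi_j=\mathbf v_j^T\mathbf U\mathbf v_j$ in decreasing order ($\phi_{(d+1)}:=0$)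 and $\Delta_{\mathbf U}=\phi_{(u)}-\phi_{(u+1)}$. **Estimator.** Let $\mathcal X\in\mathbb R^{n\times p}$ and $\mathcal Y\in\mathbb R^{n\times r}$ be the data matrices, whose rows are the observations minus their sample means, and let $\tau=\tau_k>\max_{1\le j\le d}\Vert\mathbf v_j\Vert_1$ be the tuning parameter. Put $\mathcal Y^1=\mathcal Y$ and, for $j=1,\dots,d$, let $(\widehat{\mathbf u}_j,\widehat{\mathbf v}_j)$ be any maximizer of $\mathbf u^T\mathcal Y^j\mathbf v$ subject to $\Vert\mathbf v\Vert_1\le\tau$, $\Vert\mathbf v\Vert_2\le1$, $\Vert\mathbf u\Vert_2\le1$, and $\mathcal Y^{j+1}=\mathcal Y^j-(\widehat{\mathbf u}_j^T\mathcal Y^j\widehat{\mathbf v}_j)\widehat{\mathbf u}_j\widehat{\mathbf v}_j^T$. The sparse NIECE estimator $\widehat{\mathcal E}$ is the span of the $u$ vectors $\widehat{\mathbf v}_j$ with the largest scores $\widehat{\mathbf v}_j^T\widehat{\mathbf U}\widehat{\mathbf v}_j$ (ties broken arbitrarily), where $\widehat{\mathbf U}=\widehat{\boldsymbol\Sigma}_{\mathbf{YX}}\widehat{\boldsymbol\Sigma}_{\mathbf{XY}}$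 and $\widehat{\boldsymbol\Sigma}_{\mathbf{XY}}=\widehat{\boldsymbol\Sigma}_{\mathbf{YX}}^T=n^{-1}\mathcal X^T\mathcal Y$. **Corollary 2.** Suppose that $\sqrt{\log p+\log r}=o(\sqrt n)$, that $\sqrt{\log p+\log r}<\sqrt n/p$ (for all large $k$), and that $$\max\left(\tau^2\sqrt{\log p+\log r},\ \Delta_{\mathbf U}^{-2}\tau^2\sqrt{\log p+\log r}\right)=o(\sqrt n).$$ Then $\Vert\mathbf P_{\widehat{\mathcal E}}-\mathbf P_{\mathcal E}\Vert_F\to0$ in probability as $n,p,r\to\infty$. If $\mathbf X$ and $\mathbf Y$ have mean zero, the same holds for the estimator computed from the data matrices of the raw (uncentred) observations. -/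

import Mathlib

open MeasureTheory ProbabilityTheory Filter Topology Asymptotics Matrix

noncomputable section

/-! ### Subspaces, envelopes -/

/-- The matrix of the Euclidean orthogonal projection onto a subspace `K` of `ℝ^r`. -/
def projMatrix {r : ℕ} (K : Submodule ℝ (Fin r → ℝ)) : Matrix (Fin r) (Fin r) ℝ :=
  Matrix.of fun i j =>
    ((K.map (WithLp.linearEquiv 2 ℝ (Fin r → ℝ)).symm.toLinearMap).starProjection
      (EuclideanSpace.single j (1 : ℝ))) i

/-- The Frobenius norm of a real matrix. -/
def frobNorm {a b : ℕ} (A : Matrix (Fin a) (Fin b) ℝ) : ℝ :=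
  √(∑ i, ∑ j, A i j ^ 2)

/-- The column space of a matrix. -/
def colSpan {a b : ℕ} (A : Matrix (Fin a) (Fin b) ℝ) : Submodule ℝ (Fin a → ℝ) :=
  LinearMap.range A.mulVecLin

/-- `R` is a reducing subspace of `M`: `M = P_R M P_R + Q_R M Q_R` with `Q_R = I - P_R`. -/
def IsReducing {r : ℕ} (M : Matrix (Fin r) (Fin r) ℝ) (R : Submodule ℝ (Fin r → ℝ)) : Prop :=
  M = projMatrix R * M * projMatrix R + (1 - projMatrix R) * M * (1 - projMatrix R)

/-- The `M`-envelope of the column space of `U`: the intersection of all reducing subspaces of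
`M` that contain it. -/
def envelope {r b : ℕ} (M : Matrix (Fin r) (Fin r) ℝ) (U : Matrix (Fin r) (Fin b) ℝ) :
    Submodule ℝ (Fin r → ℝ) :=
  sInf {R | IsReducing M R ∧ colSpan U ≤ R}

/-! ### Eigenvalues, eigenvectors, envelope scores -/

/-- The eigenvalues of a symmetric matrix in decreasing order, with multiplicity, numbered from
`0` (so this is `λ_{j+1}(M)` when counting from one), extended by `0`. -/
def sortedEigenvalue {r : ℕ} {M : Matrix (Fin r) (Fin r) ℝ} (hM : M.IsHermitian) (j : ℕ) : ℝ :=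
  if h : j < Fintype.card (Fin r) then hM.eigenvalues₀ ⟨j, h⟩ else 0

/-- `V 0, …, V (d - 1)` are orthonormal eigenvectors of `M` belonging to its `d` largest
eigenvalues, in decreasing order of the eigenvalues. -/
structure IsLeadingEigenvectors {r d : ℕ} {M : Matrix (Fin r) (Fin r) ℝ} (hM : M.IsHermitian)
    (V : Fin d → Fin r → ℝ) : Prop where
  orthonormal : ∀ i j, V i ⬝ᵥ V j = if i = j then 1 else 0
  eigenvector : ∀ j : Fin d, M *ᵥ V j = sortedEigenvalue hM j • V j

/-- The envelope scores `φ_j = v_jᵀ U v_j`. -/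
def envelopeScore {r d : ℕ} (U : Matrix (Fin r) (Fin r) ℝ) (V : Fin d → Fin r → ℝ)
    (j : Fin d) : ℝ :=
  V j ⬝ᵥ (U *ᵥ V j)

/-- The entries of `φ` in decreasing order, numbered from `0` (so this is `φ_{(j+1)}` when counting
from one), extended by `0`. -/
def nthLargest {d : ℕ} (φ : Fin d → ℝ) (j : ℕ) : ℝ :=
  if h : j < d then φ (Tuple.sort (fun i => -φ i) ⟨j, h⟩) else 0

/-- The envelope score gap `Δ_U = φ_{(u)} - φ_{(u+1)}`, for `1 ≤ u ≤ d`. -/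
def scoreGap {r d : ℕ} (U : Matrix (Fin r) (Fin r) ℝ) (V : Fin d → Fin r → ℝ) (u : ℕ) : ℝ :=
  nthLargest (envelopeScore U V) (u - 1) - nthLargest (envelopeScore U V) u

/-! ### The penalized matrix decomposition and the sparse NIECE estimator -/

/-- The `ℓ₁` norm of a vector. -/
def l1Norm {r : ℕ} (v : Fin r → ℝ) : ℝ := ∑ i, |v i|

/-- The constraint set of the penalized matrix decomposition:
`‖v‖₁ ≤ c`, `‖v‖₂² ≤ 1`, `‖u‖₂² ≤ 1`. -/
def pmdFeasible (n r : ℕ) (c : ℝ) : Set ((Fin n → ℝ) × (Fin r → ℝ)) :=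
  {w | l1Norm w.2 ≤ c ∧ w.2 ⬝ᵥ w.2 ≤ 1 ∧ w.1 ⬝ᵥ w.1 ≤ 1}

/-- The successively deflated data matrices: `X¹ = A` and `X^{k+1} = X^k - σ̂_k û_k v̂_kᵀ` with
`σ̂_k = û_kᵀ X^k v̂_k` (the numbering below starts from `0`). -/
def deflated {n r : ℕ} (A : Matrix (Fin n) (Fin r) ℝ) (uhat : ℕ → Fin n → ℝ)
    (vhat : ℕ → Fin r → ℝ) : ℕ → Matrix (Fin n) (Fin r) ℝ
  | 0 => A
  | k + 1 => deflated A uhat vhat k -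
      (uhat k ⬝ᵥ (deflated A uhat vhat k *ᵥ vhat k)) • vecMulVec (uhat k) (vhat k)

/-- The first `d` pairs `(û_k, v̂_k)` are an output of the penalized matrix decomposition of the
data matrix `A` with tuning parameter `c`: each pair maximizes `uᵀ X^k v` over the constraint
set (any maximizer is allowed). -/
def IsPMD {n r : ℕ} (A : Matrix (Fin n) (Fin r) ℝ) (c : ℝ) (d : ℕ) (uhat : ℕ → Fin n → ℝ)
    (vhat : ℕ → Fin r → ℝ) : Prop :=
  ∀ k < d, (uhat k, vhat k) ∈ pmdFeasible n r c ∧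
    ∀ w ∈ pmdFeasible n r c,
      w.1 ⬝ᵥ (deflated A uhat vhat k *ᵥ w.2) ≤ uhat k ⬝ᵥ (deflated A uhat vhat k *ᵥ vhat k)

/-- The sample cross-covariance matrix `Σ̂_XY = n⁻¹ 𝒳ᵀ 𝒴` of two data matrices, whose rows are the
(possibly centred) observations. -/
def sampleCrossCov {n p r : ℕ} (A : Matrix (Fin n) (Fin p) ℝ) (B : Matrix (Fin n) (Fin r) ℝ) :
    Matrix (Fin p) (Fin r) ℝ :=
  (n : ℝ)⁻¹ • (Aᵀ * B)

/-- `Û = Σ̂_YX Σ̂_XY`. -/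
def sampleU {n p r : ℕ} (A : Matrix (Fin n) (Fin p) ℝ) (B : Matrix (Fin n) (Fin r) ℝ) :
    Matrix (Fin r) (Fin r) ℝ :=
  (sampleCrossCov A B)ᵀ * sampleCrossCov A B

/-- `K` is a sparse NIECE estimate of the response envelope from the predictor data matrix `A` and
the response data matrix `B`, with tuning parameter `c`, `d` components and envelope dimension `u`:
the `v̂_j` are sparse directions computed from `B` by the penalized matrix decomposition, they are
arranged by decreasing estimated scores `v̂_jᵀ Û v̂_j` (ties are broken in any way), and `K` is the
span of the first `u` of them. -/
def IsSparseNIECE {n p r : ℕ} (A : Matrix (Fin n) (Fin p) ℝ) (B : Matrix (Fin n) (Fin r) ℝ)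
    (c : ℝ) (d u : ℕ) (K : Submodule ℝ (Fin r → ℝ)) : Prop :=
  ∃ (uhat : ℕ → Fin n → ℝ) (vhat : ℕ → Fin r → ℝ) (perm : Equiv.Perm (Fin d)),
    IsPMD B c d uhat vhat ∧
    Antitone (fun j : Fin d =>
      envelopeScore (sampleU A B) (fun i : Fin d => vhat i) (perm j)) ∧
    K = Submodule.span ℝ {v | ∃ j : Fin d, (j : ℕ) < u ∧ v = vhat (perm j)}

/-- The data matrix whose `i`-th row is the `i`-th observation. -/
def dataMatrix {Ω : Type*} {n q : ℕ} (Z : Fin n → Ω → Fin q → ℝ) (ω : Ω) :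
    Matrix (Fin n) (Fin q) ℝ :=
  Matrix.of fun i j => Z i ω j

/-- The data matrix after subtraction of the sample mean from every row. -/
def centredRows {n q : ℕ} (A : Matrix (Fin n) (Fin q) ℝ) : Matrix (Fin n) (Fin q) ℝ :=
  Matrix.of fun i j => A i j - (n : ℝ)⁻¹ * ∑ i', A i' j

/-! ### The multivariate linear model -/

/-- The cross-covariance matrix of two random vectors. -/
def covMatrix {Ω : Type*} [MeasurableSpace Ω] {a b : ℕ} (P : Measure Ω)
    (X : Ω → Fin a → ℝ) (Y : Ω → Fin b → ℝ) : Matrix (Fin a) (Fin b) ℝ :=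
  Matrix.of fun i j => cov[fun ω => X ω i, fun ω => Y ω j; P]

theorem covMatrix_isHermitian {Ω : Type*} [MeasurableSpace Ω] {a : ℕ} (P : Measure Ω)
    (X : Ω → Fin a → ℝ) : (covMatrix P X X).IsHermitian := by
  ext i j
  simp [covMatrix, covariance_comm]

/-- `U = Σ_YX Σ_XY`. -/
def popU {Ω : Type*} [MeasurableSpace Ω] {p r : ℕ} (P : Measure Ω)
    (X : Ω → Fin p → ℝ) (Y : Ω → Fin r → ℝ) : Matrix (Fin r) (Fin r) ℝ :=
  covMatrix P Y X * covMatrix P X Y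

/-- The response envelope `E_{Σ_Y}(Σ_YX)`. It is the envelope of the column space of
`U = Σ_YX Σ_XY`, which is that of `Σ_YX`. -/
def responseEnvelope {Ω : Type*} [MeasurableSpace Ω] {p r : ℕ} (P : Measure Ω)
    (X : Ω → Fin p → ℝ) (Y : Ω → Fin r → ℝ) : Submodule ℝ (Fin r → ℝ) :=
  envelope (covMatrix P Y Y) (popU P X Y)

/-- The multivariate linear model `Y = α + β X + ε` with `ε` independent of `X`. -/
structure IsLinearModel {Ω : Type*} [MeasurableSpace Ω] {p r : ℕ} (P : Measure Ω)
    (α : Fin r → ℝ) (β : Matrix (Fin r) (Fin p) ℝ)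
    (X : Ω → Fin p → ℝ) (Y ε : Ω → Fin r → ℝ) : Prop where
  aemeasurable_predictor : AEMeasurable X P
  aemeasurable_error : AEMeasurable ε P
  indep : IndepFun X ε P
  equation : ∀ ω, Y ω = α + β *ᵥ X ω + ε ω

/-- The joint sub-Gaussian tail condition on `(X, Y)` with parameter `σ`. The unit vector of
`ℝ^{p+r}` is written as a pair `(w, z)`. -/
def IsJointSubGaussian {Ω : Type*} [MeasurableSpace Ω] {p r : ℕ} (P : Measure Ω) (σ : ℝ)
    (X : Ω → Fin p → ℝ) (Y : Ω → Fin r → ℝ) : Prop :=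
  ∀ (w : Fin p → ℝ) (z : Fin r → ℝ), w ⬝ᵥ w + z ⬝ᵥ z = 1 → ∀ t : ℝ, 0 ≤ t →
    P.real {ω | t ≤ |w ⬝ᵥ X ω + z ⬝ᵥ Y ω|} ≤ 2 * Real.exp (-(t ^ 2 / σ ^ 2))

/-- The pairs `(Xs i, Ys i)` are independent copies of the pair `(X, Y)`. -/
structure IsIIDSample {Ω : Type*} [MeasurableSpace Ω] {n p r : ℕ} (P : Measure Ω)
    (X : Ω → Fin p → ℝ) (Y : Ω → Fin r → ℝ)
    (Xs : Fin n → Ω → Fin p → ℝ) (Ys : Fin n → Ω → Fin r → ℝ) : Prop where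
  indep : iIndepFun (fun i ω => (Xs i ω, Ys i ω)) P
  identDistrib : ∀ i, IdentDistrib (fun ω => (Xs i ω, Ys i ω)) (fun ω => (X ω, Y ω)) P P

/-- `‖P_Ê - P_E‖_F → 0` in probability, for random subspaces `Ê k` on probability spaces that may
change with `k`. No measurability of `Ê k` is required: the measure of a set that is not measurable
is its outer measure. -/
def SubspaceConsistent {Ω : ℕ → Type*} [∀ k, MeasurableSpace (Ω k)] (P : ∀ k, Measure (Ω k))
    {r : ℕ → ℕ} (E : ∀ k, Submodule ℝ (Fin (r k) → ℝ))
    (Ehat : ∀ k, Ω k → Submodule ℝ (Fin (r k) → ℝ)) : Prop :=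
  ∀ δ : ℝ, 0 < δ → Tendsto
    (fun k => P k {ω | δ ≤ frobNorm (projMatrix (Ehat k ω) - projMatrix (E k))}) atTop (𝓝 0)

end

/-! ### Orthogonal projection matrices -/

section Projection

variable {r : ℕ} (K : Submodule ℝ (Fin r → ℝ))

/-! The proof joins a deterministic bound, with constants free of `n`, `p`, `r`, to entrywise
concentration of sample covariances. Let `ε` bound the entrywise errors of the two sample covariance
matrices and put `ρ = τ² ε`.

Population. The gaps make the first `d` eigenvalues simple, and the projection onto a reducing
subspace commutes with `M`, so such a subspace contains each `v_j` or is orthogonal to it. Hence the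
envelope is spanned by the `v_j` with positive score (`envelope_eq_span`). Exactly `u` scores are
positive, and `Δ_U` is the smallest of these.

Directions. Optimality in `u` gives `X^k v̂_k = σ̂_k û_k`, so deflation is multiplication on the
right by `1 - v̂_k v̂_kᵀ` (`deflated_mulVec`). Thus `v̂_k` maximizes a deflated quadratic form of
the sample covariance. Deflation keeps ℓ₁ norms of order `τ`, so replacing the sample covariance by
`M` costs `O(ρ)`, and `v̂_k` is a nearly optimal solution of a population problem. A stability
argument (`norm_sub_le_of_nearly_optimal`) bounds its distance to `±v_k` by `O(√ρ)`, with no loss of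
rate from one step to the next.

Selection. With `p ε` bounded, estimated scores are within `O(√ρ)` of the true ones. If this is
below `Δ_U / 2`, the `u` largest estimated scores have the right indices, and the squared projection
error is `O(ρ)` (`exists_sparseNIECE_bound`).

Probability. A Bernstein bound and a union bound allow `ε` of order `√((log p + log r) / n)`; the
growth conditions then give `ρ → 0`, `ρ / Δ_U² → 0` and `p ε = O(1)`. -/

theorem projMatrix_mulVec (x : Fin r → ℝ) :
    projMatrix K *ᵥ x = WithLp.ofLp
      ((K.map (WithLp.linearEquiv 2 ℝ (Fin r → ℝ)).symm.toLinearMap).starProjection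
        (WithLp.toLp 2 x)) := by
  have hx : WithLp.toLp 2 x = ∑ j, x j • EuclideanSpace.single j (1 : ℝ) := by
    ext i
    simp [Finset.sum_apply, Pi.single_apply]
  rw [hx, map_sum]
  ext i
  simp [projMatrix, Matrix.mulVec, dotProduct, mul_comm]

theorem projMatrix_mulVec_mem (x : Fin r → ℝ) : projMatrix K *ᵥ x ∈ K := by
  rw [projMatrix_mulVec]
  obtain ⟨y, hy, h⟩ := Submodule.mem_map.1
    (Submodule.starProjection_apply_mem
      (K.map (WithLp.linearEquiv 2 ℝ (Fin r → ℝ)).symm.toLinearMap) (WithLp.toLp 2 x))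
  rw [← h]
  exact hy

variable {K} in
theorem projMatrix_mulVec_eq_of_orthogonal {x y : Fin r → ℝ} (hy : y ∈ K)
    (h : ∀ w ∈ K, (x - y) ⬝ᵥ w = 0) : projMatrix K *ᵥ x = y := by
  rw [projMatrix_mulVec, Submodule.eq_starProjection_of_mem_of_inner_eq_zero
    (v := WithLp.toLp 2 y) (Submodule.mem_map.2 ⟨y, hy, rfl⟩)]
  rintro _ ⟨w, hw, rfl⟩
  have := h w hw
  rw [dotProduct_comm] at this
  simpa [← WithLp.toLp_sub, EuclideanSpace.inner_toLp_toLp] using this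

theorem sub_projMatrix_mulVec_dotProduct (x : Fin r → ℝ) {w : Fin r → ℝ} (hw : w ∈ K) :
    (x - projMatrix K *ᵥ x) ⬝ᵥ w = 0 := by
  have h := Submodule.starProjection_inner_eq_zero (𝕜 := ℝ)
    (K := K.map (WithLp.linearEquiv 2 ℝ (Fin r → ℝ)).symm.toLinearMap) (WithLp.toLp 2 x)
    (WithLp.toLp 2 w) (Submodule.mem_map.2 ⟨w, hw, rfl⟩)
  rw [projMatrix_mulVec]
  simpa [EuclideanSpace.inner_eq_star_dotProduct, dotProduct_comm] using h

variable {K} in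
theorem projMatrix_mulVec_of_mem {x : Fin r → ℝ} (hx : x ∈ K) : projMatrix K *ᵥ x = x :=
  projMatrix_mulVec_eq_of_orthogonal hx (by simp)

theorem projMatrix_mul_self : projMatrix K * projMatrix K = projMatrix K := by
  refine Matrix.ext_iff_mulVec.2 fun x => ?_
  rw [← Matrix.mulVec_mulVec, projMatrix_mulVec_of_mem (projMatrix_mulVec_mem K x)]

theorem projMatrix_mulVec_dotProduct (x y : Fin r → ℝ) :
    (projMatrix K *ᵥ x) ⬝ᵥ y = x ⬝ᵥ (projMatrix K *ᵥ y) := by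
  have h1 := sub_projMatrix_mulVec_dotProduct K x (projMatrix_mulVec_mem K y)
  have h2 := sub_projMatrix_mulVec_dotProduct K y (projMatrix_mulVec_mem K x)
  rw [sub_dotProduct] at h1 h2
  rw [dotProduct_comm (projMatrix K *ᵥ x) y, sub_eq_zero.1 h2, sub_eq_zero.1 h1,
    dotProduct_comm]

theorem projMatrix_transpose : (projMatrix K)ᵀ = projMatrix K := by
  ext i j
  have := projMatrix_mulVec_dotProduct K (Pi.single i 1) (Pi.single j 1)
  simpa using this

theorem trace_projMatrix : (projMatrix K).trace = Module.finrank ℝ K := by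
  rw [← Matrix.trace_toLin'_eq]
  refine LinearMap.IsProj.trace (p := K) ⟨fun x => ?_, fun x hx => ?_⟩
  · simpa using projMatrix_mulVec_mem K x
  · simpa using projMatrix_mulVec_of_mem hx

theorem dotProduct_self_nonneg {m : ℕ} (x : Fin m → ℝ) : 0 ≤ x ⬝ᵥ x :=
  Finset.sum_nonneg fun i _ => mul_self_nonneg (x i)

variable {K} in
-- For a unit vector, `v ⬝ᵥ P v` is one minus the squared distance to `K`, and that distance is at
-- most `‖v - w‖`.
theorem one_sub_le_dotProduct_projMatrix {v w : Fin r → ℝ} (hv : v ⬝ᵥ v = 1) (hw : w ∈ K) :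
    1 - (v - w) ⬝ᵥ (v - w) ≤ v ⬝ᵥ (projMatrix K *ᵥ v) := by
  set p := projMatrix K *ᵥ v with hp
  have h1 : (v - p) ⬝ᵥ p = 0 := sub_projMatrix_mulVec_dotProduct K v (projMatrix_mulVec_mem K v)
  have h2 : (v - p) ⬝ᵥ w = 0 := sub_projMatrix_mulVec_dotProduct K v hw
  have h3 := dotProduct_self_nonneg (p - w)
  simp only [sub_dotProduct, dotProduct_sub] at *
  have h4 := dotProduct_comm v w
  have h5 := dotProduct_comm v p
  have h6 := dotProduct_comm w p
  linarith

theorem projMatrix_span_orthonormal {d : ℕ} {v : Fin d → Fin r → ℝ}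
    (hv : ∀ i j, v i ⬝ᵥ v j = if i = j then 1 else 0) (S : Finset (Fin d)) :
    projMatrix (Submodule.span ℝ (v '' S)) = ∑ j ∈ S, vecMulVec (v j) (v j) := by
  refine Matrix.ext_iff_mulVec.2 fun x => ?_
  have hform : (∑ j ∈ S, vecMulVec (v j) (v j)) *ᵥ x = ∑ j ∈ S, (v j ⬝ᵥ x) • v j := by
    rw [Matrix.sum_mulVec]
    refine Finset.sum_congr rfl fun j _ => ?_
    rw [vecMulVec_mulVec]
    ext i; simp [mul_comm]
  rw [hform]
  refine projMatrix_mulVec_eq_of_orthogonal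
    (Submodule.sum_mem _ fun j hj => Submodule.smul_mem _ _ (Submodule.subset_span ⟨j, hj, rfl⟩))
    fun w hw => ?_
  induction hw using Submodule.span_induction with
  | mem w hw =>
    obtain ⟨i, hi, rfl⟩ := hw
    have : ∑ j ∈ S, (v j ⬝ᵥ x) * (v j ⬝ᵥ v i) = v i ⬝ᵥ x := by
      simp only [hv, mul_ite, mul_one, mul_zero]
      rw [Finset.sum_ite_eq' S i, if_pos (by simpa using hi)]
    rw [sub_dotProduct, sum_dotProduct]
    simp only [smul_dotProduct, smul_eq_mul]
    rw [this, dotProduct_comm, sub_self]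
  | zero => simp
  | add a b _ _ ha hb => rw [dotProduct_add, ha, hb, add_zero]
  | smul c a _ ha => rw [dotProduct_smul, ha, smul_zero]

theorem frobNorm_sq {a b : ℕ} (A : Matrix (Fin a) (Fin b) ℝ) :
    frobNorm A ^ 2 = (Aᵀ * A).trace := by
  have h : 0 ≤ ∑ i, ∑ j, A i j ^ 2 :=
    Finset.sum_nonneg fun i _ => Finset.sum_nonneg fun j _ => sq_nonneg _
  refine (Real.sq_sqrt h).trans ?_
  rw [Finset.sum_comm]
  simp [Matrix.trace, Matrix.mul_apply, sq]

/-- The squared distance of two projections is the sum of their ranks minus twice the trace of their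
product. Only the rank of `K` enters, so the `w j` need be neither orthogonal nor independent. -/
theorem frobNorm_projMatrix_sub_sq_le {d : ℕ} {v w : Fin d → Fin r → ℝ}
    (hv : ∀ i j, v i ⬝ᵥ v j = if i = j then 1 else 0) (S : Finset (Fin d))
    (hw : ∀ j ∈ S, w j ∈ K) (hK : Module.finrank ℝ K ≤ S.card) :
    frobNorm (projMatrix K - projMatrix (Submodule.span ℝ (v '' S))) ^ 2 ≤
      2 * ∑ j ∈ S, (v j - w j) ⬝ᵥ (v j - w j) := by
  have hself := projMatrix_mul_self (Submodule.span ℝ (v '' (S : Set (Fin d))))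
  have htr : (projMatrix (Submodule.span ℝ (v '' (S : Set (Fin d))))).trace = S.card := by
    rw [projMatrix_span_orthonormal hv, Matrix.trace_sum]
    simp [trace_vecMulVec, hv]
  have hcross : (projMatrix K * projMatrix (Submodule.span ℝ (v '' (S : Set (Fin d))))).trace =
      ∑ j ∈ S, v j ⬝ᵥ (projMatrix K *ᵥ v j) := by
    rw [projMatrix_span_orthonormal hv, Finset.mul_sum, Matrix.trace_sum]
    refine Finset.sum_congr rfl fun j _ => ?_
    rw [mul_vecMulVec, trace_vecMulVec, dotProduct_comm]
  have hle : ∑ j ∈ S, (1 - (v j - w j) ⬝ᵥ (v j - w j)) ≤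
      ∑ j ∈ S, v j ⬝ᵥ (projMatrix K *ᵥ v j) :=
    Finset.sum_le_sum fun j hj => one_sub_le_dotProduct_projMatrix (by simp [hv]) (hw j hj)
  rw [Finset.sum_sub_distrib] at hle
  have hK' : (Module.finrank ℝ K : ℝ) ≤ S.card := by exact_mod_cast hK
  rw [frobNorm_sq, transpose_sub, projMatrix_transpose, projMatrix_transpose, Matrix.sub_mul,
    Matrix.mul_sub, Matrix.mul_sub, projMatrix_mul_self, hself, Matrix.trace_sub,
    Matrix.trace_sub, Matrix.trace_sub, Matrix.trace_mul_comm (projMatrix (Submodule.span _ _)),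
    hcross, htr, trace_projMatrix]
  simp only [Finset.sum_const, nsmul_eq_mul, mul_one] at hle
  linarith

end Projection

/-! ### Spectral decomposition in sorted order -/

section Spectral

variable {r d : ℕ} {M : Matrix (Fin r) (Fin r) ℝ} (hM : M.IsHermitian)

theorem exists_sorted_eigenbasis : ∃ e : Fin r → Fin r → ℝ,
    (∀ i j, e i ⬝ᵥ e j = if i = j then 1 else 0) ∧
    (∀ i : Fin r, M *ᵥ e i = sortedEigenvalue hM i • e i) ∧
    ∀ x, ∑ i, (e i ⬝ᵥ x) • e i = x := by
  -- This is the equivalence by which `IsHermitian.eigenvalues` indexes `eigenvalues₀`; undoing it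
  -- puts the eigenbasis in sorted order.
  set f : Fin (Fintype.card (Fin r)) ≃ Fin r :=
    Fintype.equivOfCardEq (Fintype.card_fin _) with hf
  set g : Fin r ≃ Fin r := (finCongr (Fintype.card_fin r).symm).trans f with hg
  set b := hM.eigenvectorBasis.reindex g.symm with hb
  have hbi : ∀ i, b i = hM.eigenvectorBasis (g i) := fun i => by simp [hb]
  refine ⟨fun i => (b i).ofLp, fun i j => ?_, fun i => ?_, fun x => ?_⟩
  · have := (orthonormal_iff_ite.1 b.orthonormal) i j
    rw [EuclideanSpace.inner_eq_star_dotProduct, dotProduct_comm] at this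
    simpa using this
  · simp only [hbi]
    rw [hM.mulVec_eigenvectorBasis]
    congr 1
    have hi : (i : ℕ) < Fintype.card (Fin r) := by simp
    rw [sortedEigenvalue, dif_pos hi, IsHermitian.eigenvalues]
    congr 1
    rw [Equiv.symm_apply_eq]
    rfl
  · have := b.sum_repr' (WithLp.toLp 2 x)
    have h2 := congrArg WithLp.ofLp this
    rw [WithLp.ofLp_sum] at h2
    refine Eq.trans (Finset.sum_congr rfl fun i _ => ?_) h2
    rw [WithLp.ofLp_smul, EuclideanSpace.inner_eq_star_dotProduct, dotProduct_comm]
    simp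

theorem sortedEigenvalue_antitone {i j : ℕ} (hij : i ≤ j) (hj : j < r) :
    sortedEigenvalue hM j ≤ sortedEigenvalue hM i := by
  have hj' : j < Fintype.card (Fin r) := by simpa using hj
  rw [sortedEigenvalue, sortedEigenvalue, dif_pos hj', dif_pos (hij.trans_lt hj')]
  exact hM.eigenvalues₀_antitone hij

theorem sortedEigenvalue_of_le {j : ℕ} (hj : r ≤ j) : sortedEigenvalue hM j = 0 := by
  rw [sortedEigenvalue, dif_neg]
  simpa using hj

theorem sortedEigenvalue_nonneg (hpos : ∀ x, 0 ≤ x ⬝ᵥ (M *ᵥ x)) (j : ℕ) :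
    0 ≤ sortedEigenvalue hM j := by
  rcases lt_or_ge j r with hj | hj
  · obtain ⟨e, he, hMe, -⟩ := exists_sorted_eigenbasis hM
    have := hpos (e ⟨j, hj⟩)
    rw [hMe, dotProduct_smul, he] at this
    simpa using this
  · rw [sortedEigenvalue_of_le hM hj]

theorem mulVec_dotProduct_of_isHermitian (hM : M.IsHermitian) (x y : Fin r → ℝ) :
    (M *ᵥ x) ⬝ᵥ y = x ⬝ᵥ (M *ᵥ y) := by
  have h : Mᵀ = M := by simpa [conjTranspose_eq_transpose_of_trivial] using hM.eq
  rw [dotProduct_mulVec, ← mulVec_transpose, h]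

variable {Δ : ℝ}

/-- Beyond index `r` the eigenvalues are `0` by convention, so a positive gap at index `r` is
impossible. -/
theorem dim_le_of_gap (hΔ : 0 < Δ)
    (hgap : ∀ j < d, Δ ≤ sortedEigenvalue hM j - sortedEigenvalue hM (j + 1)) : d ≤ r := by
  by_contra! h
  have := hgap r h
  rw [sortedEigenvalue_of_le hM le_rfl, sortedEigenvalue_of_le hM (Nat.le_succ r)] at this
  linarith

theorem sortedEigenvalue_ne (hΔ : 0 < Δ)
    (hgap : ∀ j < d, Δ ≤ sortedEigenvalue hM j - sortedEigenvalue hM (j + 1)) {i j : ℕ}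
    (hi : i < r) (hj : j < d) (hij : i ≠ j) :
    sortedEigenvalue hM i ≠ sortedEigenvalue hM j := by
  have hdr := dim_le_of_gap hM hΔ hgap
  rcases lt_or_gt_of_ne hij with h | h
  · have h1 := sortedEigenvalue_antitone hM (Nat.succ_le_of_lt h) (hj.trans_le hdr)
    have h2 := hgap i (h.trans hj)
    rw [Nat.succ_eq_add_one] at h1
    intro h3; linarith
  · have h1 := sortedEigenvalue_antitone hM (Nat.succ_le_of_lt h) hi
    have h2 := hgap j hj
    rw [Nat.succ_eq_add_one] at h1
    intro h3; linarith

variable {V : Fin d → Fin r → ℝ}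

theorem eq_smul_of_eigenvector (hΔ : 0 < Δ)
    (hgap : ∀ j < d, Δ ≤ sortedEigenvalue hM j - sortedEigenvalue hM (j + 1))
    {e : Fin r → Fin r → ℝ}
    (hMe : ∀ i : Fin r, M *ᵥ e i = sortedEigenvalue hM i • e i)
    (hex : ∀ x, ∑ i, (e i ⬝ᵥ x) • e i = x) (j : Fin d) {i : Fin r} (hij : (i : ℕ) = j)
    {x : Fin r → ℝ} (hx : M *ᵥ x = sortedEigenvalue hM j • x) : x = (e i ⬝ᵥ x) • e i := by
  conv_lhs => rw [← hex x]
  refine Finset.sum_eq_single i (fun k _ hk => ?_) (by simp)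
  have hne := sortedEigenvalue_ne hM hΔ hgap k.2 j.2 (fun h => hk (Fin.ext (h.trans hij.symm)))
  have h := mulVec_dotProduct_of_isHermitian hM (e k) x
  rw [hMe, hx, smul_dotProduct, dotProduct_smul, smul_eq_mul, smul_eq_mul] at h
  have : e k ⬝ᵥ x = 0 := by
    by_contra h0
    exact hne (mul_right_cancel₀ h0 h)
  rw [this, zero_smul]

/-- The `j`-th eigenvalue is simple, so `x` and `V j` are both multiples of the same vector of a
full eigenbasis. -/
theorem IsLeadingEigenvectors.eq_smul (hV : IsLeadingEigenvectors hM V) (hΔ : 0 < Δ)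
    (hgap : ∀ j < d, Δ ≤ sortedEigenvalue hM j - sortedEigenvalue hM (j + 1)) (j : Fin d)
    {x : Fin r → ℝ} (hx : M *ᵥ x = sortedEigenvalue hM j • x) : x = (V j ⬝ᵥ x) • V j := by
  obtain ⟨e, he, hMe, hex⟩ := exists_sorted_eigenbasis hM
  have hj : (j : ℕ) < r := j.2.trans_le (dim_le_of_gap hM hΔ hgap)
  have h1 := eq_smul_of_eigenvector hM hΔ hgap hMe hex j (i := ⟨j, hj⟩) rfl hx
  have h2 := eq_smul_of_eigenvector hM hΔ hgap hMe hex j (i := ⟨j, hj⟩) rfl (hV.eigenvector j)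
  set c := e ⟨j, hj⟩ ⬝ᵥ V j
  set a := e ⟨j, hj⟩ ⬝ᵥ x
  have hc : c * c = 1 := by
    have := hV.orthonormal j j
    rw [h2, smul_dotProduct, dotProduct_smul, he] at this
    simpa using this
  rw [h2, h1, smul_dotProduct, dotProduct_smul, he, smul_smul]
  congr 1
  simp only [if_true, smul_eq_mul, mul_one]
  linear_combination (-a) * hc

/-- In an eigenbasis the coefficients of `y` before `j` vanish, and all later eigenvalues are at
most the next one. This curvature bound is what identifies a near maximizer. -/
theorem IsLeadingEigenvectors.quadratic_form_le (hV : IsLeadingEigenvectors hM V) (hΔ : 0 < Δ)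
    (hgap : ∀ j < d, Δ ≤ sortedEigenvalue hM j - sortedEigenvalue hM (j + 1)) (j : Fin d)
    {y : Fin r → ℝ} (hy : ∀ i < j, V i ⬝ᵥ y = 0) :
    y ⬝ᵥ (M *ᵥ y) ≤ sortedEigenvalue hM j * (V j ⬝ᵥ y) ^ 2 +
      sortedEigenvalue hM (j + 1) * (y ⬝ᵥ y - (V j ⬝ᵥ y) ^ 2) := by
  obtain ⟨e, he, hMe, hex⟩ := exists_sorted_eigenbasis hM
  have hdr := dim_le_of_gap hM hΔ hgap
  have hj : (j : ℕ) < r := j.2.trans_le hdr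
  have hyy : y ⬝ᵥ y = ∑ i, (e i ⬝ᵥ y) ^ 2 := by
    conv_lhs => rw [← hex y]
    rw [sum_dotProduct]
    refine Finset.sum_congr rfl fun i _ => ?_
    rw [hex y, smul_dotProduct, smul_eq_mul, sq]
  have hyM : y ⬝ᵥ (M *ᵥ y) = ∑ i : Fin r, sortedEigenvalue hM i * (e i ⬝ᵥ y) ^ 2 := by
    rw [← mulVec_dotProduct_of_isHermitian hM]
    conv_lhs => rw [← hex y, mulVec_sum]
    rw [sum_dotProduct]
    refine Finset.sum_congr rfl fun i _ => ?_
    rw [hex y, mulVec_smul, hMe, smul_smul, smul_dotProduct, smul_eq_mul]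
    ring
  have hVe : (V j ⬝ᵥ y) ^ 2 = (e ⟨j, hj⟩ ⬝ᵥ y) ^ 2 := by
    have h2 := eq_smul_of_eigenvector hM hΔ hgap hMe hex j (i := ⟨j, hj⟩) rfl (hV.eigenvector j)
    set c := e ⟨j, hj⟩ ⬝ᵥ V j
    have hc : c * c = 1 := by
      have := hV.orthonormal j j
      rw [h2, smul_dotProduct, dotProduct_smul, he] at this
      simpa using this
    rw [h2, smul_dotProduct, smul_eq_mul]
    linear_combination (e ⟨j, hj⟩ ⬝ᵥ y) ^ 2 * hc
  have h0 : ∀ i : Fin r, (i : ℕ) < j → e i ⬝ᵥ y = 0 := by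
    intro i hi
    have h2 := hV.eq_smul hM hΔ hgap ⟨i, hi.trans j.2⟩ (hMe i)
    rw [h2, smul_dotProduct, hy ⟨i, hi.trans j.2⟩ hi, smul_zero]
  have hterm : ∀ i : Fin r, sortedEigenvalue hM i * (e i ⬝ᵥ y) ^ 2 ≤
      sortedEigenvalue hM (j + 1) * (e i ⬝ᵥ y) ^ 2 +
        if i = ⟨j, hj⟩ then (sortedEigenvalue hM j - sortedEigenvalue hM (j + 1)) *
          (e ⟨j, hj⟩ ⬝ᵥ y) ^ 2 else 0 := by
    intro i
    rcases lt_trichotomy (i : ℕ) j with h | h | h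
    · have : i ≠ ⟨j, hj⟩ := fun h' => h.ne (congrArg Fin.val h')
      simp [h0 i h, this]
    · have : i = ⟨j, hj⟩ := Fin.ext h
      subst this
      rw [if_pos rfl]
      linarith
    · have : i ≠ ⟨j, hj⟩ := fun h' => h.ne' (congrArg Fin.val h')
      rw [if_neg this, add_zero]
      exact mul_le_mul_of_nonneg_right (sortedEigenvalue_antitone hM h i.2) (sq_nonneg _)
  have hsum := Finset.sum_le_sum fun i (_ : i ∈ Finset.univ) => hterm i
  rw [Finset.sum_add_distrib, Finset.sum_ite_eq' Finset.univ, if_pos (Finset.mem_univ _),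
    ← Finset.mul_sum, ← hyy, ← hyM, ← hVe] at hsum
  linarith

end Spectral

/-! ### Structure of the envelope -/

section Envelope

variable {r : ℕ} {M : Matrix (Fin r) (Fin r) ℝ}

/-- Multiplying the reducing identity by `P` on either side leaves `P M P`. -/
theorem IsReducing.commute {R : Submodule ℝ (Fin r → ℝ)} (h : IsReducing M R) :
    projMatrix R * M = M * projMatrix R := by
  have hP := projMatrix_mul_self R
  set P := projMatrix R
  have h' : M = P * M * P + (1 - P) * M * (1 - P) := h
  have h1 : P * M = P * M * P := by
    conv_lhs => rw [h']
    have : P * (1 - P) = 0 := by rw [mul_sub, mul_one, hP, sub_self]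
    rw [mul_add, ← mul_assoc, ← mul_assoc, hP, ← mul_assoc, ← mul_assoc, this, zero_mul,
      zero_mul, add_zero]
  have h2 : M * P = P * M * P := by
    conv_lhs => rw [h']
    have : (1 - P) * P = 0 := by rw [sub_mul, one_mul, hP, sub_self]
    rw [add_mul, mul_assoc, hP, mul_assoc _ (1 - P) P, this, mul_zero, add_zero]
  rw [h1, h2]

theorem isReducing_of_commute {R : Submodule ℝ (Fin r → ℝ)}
    (h : projMatrix R * M = M * projMatrix R) : IsReducing M R := by
  have hP := projMatrix_mul_self R
  unfold IsReducing
  set P := projMatrix R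
  have : P * M * P = M * P := by rw [h, mul_assoc, hP]
  rw [sub_mul, one_mul, mul_sub, mul_one, sub_mul, h, mul_assoc, hP]
  abel

variable {d p : ℕ}

theorem finrank_span_image_orthonormal {v : Fin d → Fin r → ℝ}
    (hv : ∀ i j, v i ⬝ᵥ v j = if i = j then 1 else 0) (S : Finset (Fin d)) :
    Module.finrank ℝ (Submodule.span ℝ (v '' (S : Set (Fin d)))) = S.card := by
  have h : ((Module.finrank ℝ (Submodule.span ℝ (v '' (S : Set (Fin d)))) : ℕ) : ℝ) = S.card := by
    rw [← trace_projMatrix, projMatrix_span_orthonormal hv, Matrix.trace_sum]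
    simp [trace_vecMulVec, hv]
  exact_mod_cast h

theorem envelopeScore_gram (B : Matrix (Fin p) (Fin r) ℝ) (v : Fin d → Fin r → ℝ) (j : Fin d) :
    envelopeScore (Bᵀ * B) v j = (B *ᵥ v j) ⬝ᵥ (B *ᵥ v j) := by
  rw [envelopeScore, ← mulVec_mulVec, dotProduct_mulVec, vecMul_transpose]

theorem envelope_eq_span {hM : M.IsHermitian} {V : Fin d → Fin r → ℝ}
    (hV : IsLeadingEigenvectors hM V) {Δ : ℝ} (hΔ : 0 < Δ)
    (hgap : ∀ j < d, Δ ≤ sortedEigenvalue hM j - sortedEigenvalue hM (j + 1))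
    (B : Matrix (Fin p) (Fin r) ℝ)
    (henv : envelope M (Bᵀ * B) ≤ Submodule.span ℝ (Set.range V)) :
    envelope M (Bᵀ * B) = Submodule.span ℝ
      (V '' ((Finset.univ.filter fun j => 0 < envelopeScore (Bᵀ * B) V j :
        Finset (Fin d)) : Set (Fin d))) := by
  set S : Finset (Fin d) := Finset.univ.filter fun j => 0 < envelopeScore (Bᵀ * B) V j with hS
  have hcol : colSpan (Bᵀ * B) ≤ envelope M (Bᵀ * B) := le_sInf fun R hR => hR.2
  apply le_antisymm
  -- The span on the right is itself reducing. It contains the range of `Bᵀ B`: a zero score forces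
  -- `B v_j = 0`, so images have no component along such a `v_j`.
  · refine sInf_le ⟨isReducing_of_commute ?_, ?_⟩
    · rw [projMatrix_span_orthonormal hV.orthonormal, Finset.sum_mul, Finset.mul_sum]
      refine Finset.sum_congr rfl fun j _ => ?_
      have hMT : Mᵀ = M := by simpa [conjTranspose_eq_transpose_of_trivial] using hM.eq
      rw [vecMulVec_mul, mul_vecMulVec, ← mulVec_transpose, hMT, hV.eigenvector]
      ext a b
      simp [vecMulVec_apply]; ring
    · rintro x ⟨y, rfl⟩
      have hmem : (Bᵀ * B) *ᵥ y ∈ Submodule.span ℝ (Set.range V) := henv (hcol ⟨y, rfl⟩)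
      have hfull : Set.range V = V '' ((Finset.univ : Finset (Fin d)) : Set (Fin d)) := by simp
      have hx : (Bᵀ * B) *ᵥ y = ∑ j, (V j ⬝ᵥ ((Bᵀ * B) *ᵥ y)) • V j := by
        rw [hfull] at hmem
        conv_lhs => rw [← projMatrix_mulVec_of_mem hmem,
          projMatrix_span_orthonormal hV.orthonormal, Matrix.sum_mulVec]
        refine Finset.sum_congr rfl fun j _ => ?_
        rw [vecMulVec_mulVec]
        ext i; simp [mul_comm]
      rw [Matrix.mulVecLin_apply, hx]
      refine Submodule.sum_mem _ fun j _ => ?_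
      by_cases hj : j ∈ S
      · exact Submodule.smul_mem _ _ (Submodule.subset_span ⟨j, hj, rfl⟩)
      · have h0 : (B *ᵥ V j) ⬝ᵥ (B *ᵥ V j) ≤ 0 := by
          rw [← envelopeScore_gram]
          simpa [hS] using hj
        have h1 : B *ᵥ V j = 0 :=
          dotProduct_self_eq_zero.1 (le_antisymm h0 (dotProduct_self_nonneg _))
        rw [← mulVec_mulVec, dotProduct_mulVec, vecMul_transpose, h1, zero_dotProduct, zero_smul]
        exact Submodule.zero_mem _
  · rw [Submodule.span_le]
    rintro _ ⟨j, hj, rfl⟩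
    rw [SetLike.mem_coe, envelope, Submodule.mem_sInf]
    rintro R ⟨hR, hUR⟩
    have hpos : 0 < envelopeScore (Bᵀ * B) V j := by simpa [hS] using hj
    -- By simplicity `P_R v_j` is a multiple of `v_j`. Were it zero, `v_j` would be orthogonal to
    -- `R`, which contains `U v_j`, and its score would vanish.
    have heig : M *ᵥ (projMatrix R *ᵥ V j) = sortedEigenvalue hM j • (projMatrix R *ᵥ V j) := by
      rw [mulVec_mulVec, ← hR.commute, ← mulVec_mulVec, hV.eigenvector, mulVec_smul]
    have hsmul := hV.eq_smul hM hΔ hgap j heig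
    have hmem := projMatrix_mulVec_mem R (V j)
    rw [hsmul] at hmem
    refine (Submodule.smul_mem_iff _ fun h0 => ?_).1 hmem
    rw [h0, zero_smul] at hsmul
    have := sub_projMatrix_mulVec_dotProduct R (V j) (hUR ⟨V j, rfl⟩)
    rw [hsmul, sub_zero, mulVecLin_apply] at this
    exact hpos.ne' this

end Envelope

/-! ### Order statistics of the scores -/

section Order

variable {d : ℕ}

/-- The values above a threshold form an initial segment, which its cardinality determines. -/
theorem lt_iff_of_antitone {f : Fin d → ℝ} (hf : Antitone f) {h : ℝ} {u : ℕ}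
    (hu : (Finset.univ.filter fun j => h < f j).card = u) (j : Fin d) :
    h < f j ↔ (j : ℕ) < u := by
  constructor
  · intro hj
    have : Finset.Iic j ⊆ Finset.univ.filter fun j => h < f j := fun i hi => by
      simpa using hj.trans_le (hf (Finset.mem_Iic.1 hi))
    have := Finset.card_le_card this
    rw [Fin.card_Iic, hu] at this
    omega
  · intro hj
    by_contra hn
    have : (Finset.univ.filter fun j => h < f j) ⊆ Finset.Iio j := fun i hi => by
      rw [Finset.mem_Iio]
      by_contra hij
      exact hn ((Finset.mem_filter.1 hi).2.trans_le (hf (not_lt.1 hij)))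
    have := Finset.card_le_card this
    rw [Fin.card_Iio, hu] at this
    omega

theorem card_filter_comp_perm (f : Fin d → ℝ) (h : ℝ) (π : Equiv.Perm (Fin d)) :
    (Finset.univ.filter fun j => h < f (π j)).card = (Finset.univ.filter fun j => h < f j).card :=
  Finset.card_equiv π (by simp)

theorem nthLargest_gap {φ : Fin d → ℝ} (hφ : ∀ j, 0 ≤ φ j) {u : ℕ} (hu : 1 ≤ u)
    (hcard : (Finset.univ.filter fun j => 0 < φ j).card = u) :
    0 < nthLargest φ (u - 1) - nthLargest φ u ∧
      ∀ j, 0 < φ j → nthLargest φ (u - 1) - nthLargest φ u ≤ φ j := by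
  set π := Tuple.sort (fun i => -φ i) with hπ
  have hanti : Antitone fun j => φ (π j) := fun i j hij => by
    have := Tuple.monotone_sort (fun i => -φ i) hij
    simpa using this
  have hiff := lt_iff_of_antitone hanti ((card_filter_comp_perm φ 0 π).trans hcard)
  have hud : u ≤ d := by
    rw [← hcard]
    exact (Finset.card_le_univ _).trans (by simp)
  have h1 : nthLargest φ (u - 1) = φ (π ⟨u - 1, by omega⟩) := dif_pos _
  -- For `u < d` this is a score that is not positive; for `u = d` it is the default value.
  have h2 : nthLargest φ u = 0 := by
    unfold nthLargest
    split_ifs with h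
    · have := (hiff ⟨u, h⟩).not.2 (lt_irrefl u)
      exact le_antisymm (not_lt.1 this) (hφ _)
    · rfl
  rw [h1, h2, sub_zero]
  refine ⟨(hiff _).2 (show u - 1 < u by omega), fun j hj => ?_⟩
  obtain ⟨i, rfl⟩ := π.surjective j
  have := (hiff i).1 hj
  exact hanti (show (i : ℕ) ≤ u - 1 by omega)

/-- The threshold `g / 2` separates perturbed positive scores from perturbed zero scores, so ties
cannot affect which indices are selected. -/
theorem pos_iff_rank_lt {φ ψ : Fin d → ℝ} (hφ : ∀ j, 0 ≤ φ j) {u : ℕ}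
    (hcard : (Finset.univ.filter fun j => 0 < φ j).card = u) {g : ℝ}
    (hg : ∀ j, 0 < φ j → g ≤ φ j) (hclose : ∀ j, |ψ j - φ j| < g / 2)
    {π : Equiv.Perm (Fin d)} (hπ : Antitone fun j => ψ (π j)) (j : Fin d) :
    0 < φ (π j) ↔ (j : ℕ) < u := by
  have hiff : ∀ j, g / 2 < ψ j ↔ 0 < φ j := fun j => by
    have h := abs_lt.1 (hclose j)
    constructor
    · intro hj
      by_contra hn
      have := le_antisymm (not_lt.1 hn) (hφ j)
      linarith
    · intro hj
      have := hg j hj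
      linarith
  rw [← hiff]
  refine lt_iff_of_antitone hπ ?_ j
  rw [card_filter_comp_perm ψ, ← hcard]
  simp only [hiff]

end Order

/-! ### Perturbation of successive deflation -/

section Deflation

variable {H : Type*} [NormedAddCommGroup H] [InnerProductSpace ℝ H]

/-- The product of the deflations `1 - wᵢ wᵢᵀ`, `i < k`, in this order. -/
def deflate (w : ℕ → H) : ℕ → H → H
  | 0, x => x
  | k + 1, x => deflate w k (x - inner ℝ (w k) x • w k)

theorem deflate_sub (w : ℕ → H) (k : ℕ) (x y : H) :
    deflate w k (x - y) = deflate w k x - deflate w k y := by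
  induction k generalizing x y with
  | zero => rfl
  | succ k ih =>
    simp only [deflate]
    rw [← ih]
    congr 1
    rw [inner_sub_right, sub_smul]
    abel

theorem deflate_neg (w : ℕ → H) (k : ℕ) (x : H) : deflate w k (-x) = -deflate w k x := by
  have h0 := deflate_sub w k 0 0
  have h := deflate_sub w k 0 x
  rw [sub_self, sub_self] at h0
  rwa [h0, zero_sub, zero_sub] at h

theorem norm_sub_inner_smul_le {w : H} (hw : ‖w‖ ≤ 1) (x : H) : ‖x - inner ℝ w x • w‖ ≤ ‖x‖ := by
  refine (sq_le_sq₀ (norm_nonneg _) (norm_nonneg _)).1 ?_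
  rw [norm_sub_sq_real, inner_smul_right, norm_smul, Real.norm_eq_abs, mul_pow, sq_abs,
    real_inner_comm]
  have h1 : ‖w‖ ^ 2 ≤ 1 := pow_le_one₀ (norm_nonneg _) hw
  nlinarith [sq_nonneg (inner ℝ w x), mul_le_mul_of_nonneg_left h1 (sq_nonneg (inner ℝ w x))]

theorem norm_deflate_le {w : ℕ → H} {k : ℕ} (hw : ∀ i < k, ‖w i‖ ≤ 1) (x : H) :
    ‖deflate w k x‖ ≤ ‖x‖ := by
  induction k generalizing x with
  | zero => exact le_rfl
  | succ k ih =>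
    exact (ih (fun i hi => hw i (hi.trans k.lt_succ_self)) _).trans
      (norm_sub_inner_smul_le (hw k k.lt_succ_self) x)

/-- Telescoping: every factor is a contraction, and exchanging one factor costs at most `2 * η *
‖x‖`. -/
theorem norm_deflate_sub_deflate_le {w v : ℕ → H} {k : ℕ} (hw : ∀ i < k, ‖w i‖ ≤ 1)
    (hv : ∀ i < k, ‖v i‖ ≤ 1) {η : ℝ} (h : ∀ i < k, ‖w i - v i‖ ≤ η) (x : H) :
    ‖deflate w k x - deflate v k x‖ ≤ 2 * k * η * ‖x‖ := by
  induction k generalizing x with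
  | zero => simp [deflate]
  | succ k ih =>
    have hk := k.lt_succ_self
    have hη : 0 ≤ η := (norm_nonneg _).trans (h k hk)
    have hlt : ∀ i < k, i < k + 1 := fun i hi => hi.trans hk
    set a := x - inner ℝ (w k) x • w k with ha
    set b := x - inner ℝ (v k) x • v k with hb
    have h1 := ih (fun i hi => hw i (hlt i hi)) (fun i hi => hv i (hlt i hi))
      (fun i hi => h i (hlt i hi)) a
    have hax : ‖a‖ ≤ ‖x‖ := norm_sub_inner_smul_le (hw k hk) x
    have h2 : ‖a - b‖ ≤ 2 * η * ‖x‖ := by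
      have hab : a - b = -(inner ℝ (w k - v k) x • w k + inner ℝ (v k) x • (w k - v k)) := by
        rw [ha, hb, inner_sub_left, sub_smul, smul_sub]
        abel
      rw [hab, norm_neg]
      refine (norm_add_le _ _).trans ?_
      rw [norm_smul, norm_smul, Real.norm_eq_abs, Real.norm_eq_abs]
      have e1 := (abs_real_inner_le_norm (w k - v k) x).trans
        (mul_le_mul_of_nonneg_right (h k hk) (norm_nonneg x))
      have e2 := (abs_real_inner_le_norm (v k) x).trans
        (mul_le_mul_of_nonneg_right (hv k hk) (norm_nonneg x))
      have e3 := mul_le_mul e1 (hw k hk) (norm_nonneg _) (by positivity)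
      have e4 := mul_le_mul e2 (h k hk) (norm_nonneg _) (by positivity)
      linarith
    have h3 : ‖deflate v k (a - b)‖ ≤ ‖a - b‖ :=
      norm_deflate_le (fun i hi => hv i (hlt i hi)) _
    have h4 : deflate w (k + 1) x - deflate v (k + 1) x =
        (deflate w k a - deflate v k a) + deflate v k (a - b) := by
      rw [deflate_sub v k a b, deflate, deflate, ← ha, ← hb]
      abel
    rw [h4]
    refine (norm_add_le _ _).trans ?_
    have h5 : 2 * k * η * ‖a‖ ≤ 2 * k * η * ‖x‖ := by gcongr
    push_cast
    linarith

theorem deflate_of_orthogonal {v : ℕ → H} {k : ℕ} {y : H} (h : ∀ i < k, inner ℝ (v i) y = 0) :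
    deflate v k y = y := by
  induction k with
  | zero => rfl
  | succ k ih =>
    rw [deflate, h k k.lt_succ_self, zero_smul, sub_zero]
    exact ih fun i hi => h i (hi.trans k.lt_succ_self)

theorem inner_deflate_of_orthogonal {v : ℕ → H} {k : ℕ} {y : H}
    (h : ∀ i < k, inner ℝ (v i) y = 0) (x : H) : inner ℝ y (deflate v k x) = inner ℝ y x := by
  induction k generalizing x with
  | zero => rfl
  | succ k ih =>
    rw [deflate, ih (fun i hi => h i (hi.trans k.lt_succ_self)), inner_sub_right,
      inner_smul_right, real_inner_comm (v k) y, h k k.lt_succ_self, mul_zero, sub_zero]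

theorem inner_deflate_eq_zero {v : ℕ → H} {k : ℕ}
    (hv : ∀ i < k, ∀ j < k, inner ℝ (v i) (v j) = if i = j then (1 : ℝ) else 0) {i : ℕ}
    (hi : i < k) (x : H) : inner ℝ (v i) (deflate v k x) = 0 := by
  induction k generalizing x with
  | zero => omega
  | succ k ih =>
    rcases Nat.lt_succ_iff_lt_or_eq.1 hi with h | rfl
    · exact ih (fun a ha b hb => hv a (by omega) b (by omega)) h _
    · rw [deflate, inner_deflate_of_orthogonal fun j hj => ?_, inner_sub_right, inner_smul_right,
        hv i hi i hi, if_pos rfl, mul_one, sub_self]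
      rw [hv j (by omega) i hi, if_neg hj.ne]

/-- The constant in the perturbation bound for the first `k` steps of successive deflation. -/
noncomputable def deflationConst (L Δ : ℝ) : ℕ → ℝ
  | 0 => 0
  | k + 1 => deflationConst L Δ k +
      (4 / Δ + (16 * L * k * deflationConst L Δ k / Δ) ^ 2 + 1)

theorem deflationConst_nonneg {L Δ : ℝ} (hΔ : 0 < Δ) (k : ℕ) :
    0 ≤ deflationConst L Δ k := by
  induction k with
  | zero => exact le_rfl
  | succ k ih => rw [deflationConst]; positivity

/-- The crude bound `√a ≤ a + 1` keeps square roots out of `deflationConst`. -/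
theorem le_of_sq_le_mul_sq {a y s : ℝ} (ha : 0 ≤ a) (hs : 0 ≤ s) (h : y ^ 2 ≤ a * s ^ 2) :
    y ≤ (a + 1) * s := by
  refine (abs_le_of_sq_le_sq' ?_ (by positivity)).2
  nlinarith [mul_nonneg ha (sq_nonneg s), mul_nonneg (mul_nonneg ha ha) (sq_nonneg s)]

variable {M : H →ₗ[ℝ] H} {L Δ s : ℝ} {d : ℕ} {v w : ℕ → H} {lam : ℕ → ℝ}

theorem quadratic_form_sub (hM : ∀ x y, inner ℝ (M x) y = inner ℝ x (M y)) (x y : H) :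
    inner ℝ x (M x) - inner ℝ y (M y) = inner ℝ (M (x - y)) (x + y) := by
  rw [map_sub, inner_sub_left, inner_add_right, inner_add_right, hM x x, hM y y, hM x y,
    real_inner_comm x (M y)]
  ring

/-- Let `y = ‖w k - v k‖`. Optimality is known for deflation by `w`, curvature for deflation by `v`.
Passing between them changes the difference of the two objective values by only `O(s * y)`, since
that difference has a factor `w k - v k`. Hence `y² = O(s² + s * y)` and `y = O(s)`; a cruder bound
`O(s)` for the change would give only `y = O(√s)`. -/
theorem norm_sub_le_of_nearly_optimal_step
    (hM : ∀ x y, inner ℝ (M x) y = inner ℝ x (M y)) (hL : ∀ x, ‖M x‖ ≤ L * ‖x‖) (hL0 : 0 ≤ L)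
    (hΔ : 0 < Δ) (hs : 0 ≤ s) (hlam : ∀ k, 0 ≤ lam k) (hgap : ∀ k < d, Δ ≤ lam k - lam (k + 1))
    (hv : ∀ i < d, ∀ j < d, inner ℝ (v i) (v j) = if i = j then (1 : ℝ) else 0)
    (hMv : ∀ k < d, M (v k) = lam k • v k)
    (hquad : ∀ k < d, ∀ y, (∀ i < k, inner ℝ (v i) y = 0) → inner ℝ y (M y) ≤
      lam k * inner ℝ (v k) y ^ 2 + lam (k + 1) * (‖y‖ ^ 2 - inner ℝ (v k) y ^ 2))
    (hw : ∀ k < d, ‖w k‖ ≤ 1) (hpos : ∀ k < d, 0 ≤ inner ℝ (v k) (w k))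
    (hopt : ∀ k < d, inner ℝ (deflate w k (v k)) (M (deflate w k (v k))) - s ^ 2 ≤
      inner ℝ (deflate w k (w k)) (M (deflate w k (w k))))
    {k : ℕ} (hk : k < d) {C : ℝ} (hC : 0 ≤ C) (hclose : ∀ i < k, ‖w i - v i‖ ≤ C * s) :
    ‖w k - v k‖ ≤ (4 / Δ + (16 * L * k * C / Δ) ^ 2 + 1) * s := by
  have hvn : ∀ i < d, ‖v i‖ = 1 := fun i hi => by
    have := hv i hi i hi
    rw [if_pos rfl, real_inner_self_eq_norm_sq] at this
    exact (pow_eq_one_iff_of_nonneg (norm_nonneg _) two_ne_zero).1 this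
  set y := ‖w k - v k‖ with hy
  have hy0 : 0 ≤ y := norm_nonneg _
  set e := 2 * k * (C * s) with he
  have he0 : 0 ≤ e := by positivity
  have hD : ∀ x, ‖deflate w k x - deflate v k x‖ ≤ e * ‖x‖ := fun x =>
    norm_deflate_sub_deflate_le (fun i hi => hw i (hi.trans hk))
      (fun i hi => (hvn i (hi.trans hk)).le) hclose x
  have hwn : ∀ x, ‖deflate w k x‖ ≤ ‖x‖ := norm_deflate_le fun i hi => hw i (hi.trans hk)
  have hvn' : ∀ x, ‖deflate v k x‖ ≤ ‖x‖ := norm_deflate_le fun i hi => (hvn i (hi.trans hk)).le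
  have horth : ∀ i < k, inner ℝ (v i) (v k) = (0 : ℝ) := fun i hi => by
    rw [hv i (hi.trans hk) k hk, if_neg hi.ne]
  have hvk : deflate v k (v k) = v k := deflate_of_orthogonal horth
  set c := inner ℝ (v k) (w k) with hc
  have hc0 : 0 ≤ c := hpos k hk
  have hc1 : c ≤ 1 := by
    refine (real_inner_le_norm _ _).trans ?_
    rw [hvn k hk, one_mul]
    exact hw k hk
  -- the loss in the exactly deflated problem
  have hloss : Δ * (1 - c ^ 2) ≤ inner ℝ (deflate v k (v k)) (M (deflate v k (v k))) -
      inner ℝ (deflate v k (w k)) (M (deflate v k (w k))) := by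
    have h1 := hquad k hk (deflate v k (w k)) fun i hi =>
      inner_deflate_eq_zero (fun a ha b hb => hv a (ha.trans hk) b (hb.trans hk)) hi _
    rw [inner_deflate_of_orthogonal horth, ← hc] at h1
    have h2 : ‖deflate v k (w k)‖ ^ 2 ≤ 1 :=
      pow_le_one₀ (norm_nonneg _) ((hvn' _).trans (hw k hk))
    have h3 : lam (k + 1) * (‖deflate v k (w k)‖ ^ 2 - c ^ 2) ≤ lam (k + 1) * (1 - c ^ 2) :=
      mul_le_mul_of_nonneg_left (by linarith) (hlam _)
    have h4 : Δ * (1 - c ^ 2) ≤ (lam k - lam (k + 1)) * (1 - c ^ 2) :=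
      mul_le_mul_of_nonneg_right (hgap k hk) (by nlinarith)
    rw [hvk, hMv k hk, inner_smul_right, real_inner_self_eq_norm_sq, hvn k hk]
    linarith
  -- Here `‖w k - v k‖² ≤ 2 (1 - c)`, and `c² ≤ c` because `0 ≤ c ≤ 1`; the sign condition on `c` is
  -- essential.
  have hyc : y ^ 2 ≤ 2 * (1 - c ^ 2) := by
    rw [hy, norm_sub_sq_real, hvn k hk, real_inner_comm, ← hc]
    have : ‖w k‖ ^ 2 ≤ 1 := pow_le_one₀ (norm_nonneg _) (hw k hk)
    nlinarith
  -- comparison of the two deflations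
  have hsum : ‖w k + v k‖ ≤ 2 :=
    (norm_add_le _ _).trans (by have := hw k hk; rw [hvn k hk]; linarith)
  have hwadd : ∀ u : ℕ → H, deflate u k (w k + v k) = deflate u k (w k) + deflate u k (v k) := by
    intro u
    rw [← sub_neg_eq_add, deflate_sub, deflate_neg, sub_neg_eq_add]
  have hcomp : (inner ℝ (deflate w k (w k)) (M (deflate w k (w k))) -
        inner ℝ (deflate w k (v k)) (M (deflate w k (v k)))) -
      (inner ℝ (deflate v k (w k)) (M (deflate v k (w k))) -
        inner ℝ (deflate v k (v k)) (M (deflate v k (v k)))) ≤ 4 * L * e * y := by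
    rw [quadratic_form_sub hM, quadratic_form_sub hM, ← deflate_sub, ← deflate_sub, ← hwadd,
      ← hwadd]
    set a := w k - v k
    set b := w k + v k
    have hsplit : inner ℝ (M (deflate w k a)) (deflate w k b) -
        inner ℝ (M (deflate v k a)) (deflate v k b) =
        inner ℝ (M (deflate w k a - deflate v k a)) (deflate w k b) +
        inner ℝ (M (deflate v k a)) (deflate w k b - deflate v k b) := by
      rw [map_sub, inner_sub_left, inner_sub_right]; ring
    rw [hsplit]
    have e1 : inner ℝ (M (deflate w k a - deflate v k a)) (deflate w k b) ≤
        (L * (e * y)) * 2 := by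
      refine (real_inner_le_norm _ _).trans (mul_le_mul ?_ ((hwn b).trans hsum)
        (norm_nonneg _) (by positivity))
      exact (hL _).trans (mul_le_mul_of_nonneg_left (hD a) hL0)
    have e2 : inner ℝ (M (deflate v k a)) (deflate w k b - deflate v k b) ≤
        (L * y) * (e * 2) := by
      refine (real_inner_le_norm _ _).trans (mul_le_mul ?_ ((hD b).trans ?_)
        (norm_nonneg _) (by positivity))
      · exact (hL _).trans (mul_le_mul_of_nonneg_left (hvn' a) hL0)
      · exact mul_le_mul_of_nonneg_left hsum he0
    linarith
  have hmain : Δ * y ^ 2 ≤ 2 * (s ^ 2 + 4 * L * e * y) := by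
    have := hopt k hk
    have := mul_le_mul_of_nonneg_left hyc hΔ.le
    linarith
  refine le_of_sq_le_mul_sq (by positivity) hs ?_
  set t := 16 * L * k * C / Δ with ht
  have htΔ : t * Δ = 16 * L * k * C := div_mul_cancel₀ _ hΔ.ne'
  have h2 : y ^ 2 ≤ 2 / Δ * s ^ 2 + t * s * y := by
    refine le_of_mul_le_mul_left ?_ hΔ
    have : Δ * (2 / Δ * s ^ 2 + t * s * y) = 2 * s ^ 2 + (t * Δ) * s * y := by
      field_simp
    rw [this, htΔ]
    rw [he] at hmain
    linarith
  have h3 : (4 / Δ + t ^ 2) * s ^ 2 = 2 * (2 / Δ * s ^ 2) + (t * s) ^ 2 := by ring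
  rw [h3]
  -- Absorb the mixed term through `t s y ≤ (y² + t² s²) / 2`.
  nlinarith [sq_nonneg (y - t * s)]

theorem norm_sub_le_of_nearly_optimal
    (hM : ∀ x y, inner ℝ (M x) y = inner ℝ x (M y)) (hL : ∀ x, ‖M x‖ ≤ L * ‖x‖) (hL0 : 0 ≤ L)
    (hΔ : 0 < Δ) (hs : 0 ≤ s) (hlam : ∀ k, 0 ≤ lam k) (hgap : ∀ k < d, Δ ≤ lam k - lam (k + 1))
    (hv : ∀ i < d, ∀ j < d, inner ℝ (v i) (v j) = if i = j then (1 : ℝ) else 0)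
    (hMv : ∀ k < d, M (v k) = lam k • v k)
    (hquad : ∀ k < d, ∀ y, (∀ i < k, inner ℝ (v i) y = 0) → inner ℝ y (M y) ≤
      lam k * inner ℝ (v k) y ^ 2 + lam (k + 1) * (‖y‖ ^ 2 - inner ℝ (v k) y ^ 2))
    (hw : ∀ k < d, ‖w k‖ ≤ 1) (hpos : ∀ k < d, 0 ≤ inner ℝ (v k) (w k))
    (hopt : ∀ k < d, inner ℝ (deflate w k (v k)) (M (deflate w k (v k))) - s ^ 2 ≤
      inner ℝ (deflate w k (w k)) (M (deflate w k (w k)))) :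
    ∀ k < d, ‖w k - v k‖ ≤ deflationConst L Δ d * s := by
  have key : ∀ k ≤ d, ∀ i < k, ‖w i - v i‖ ≤ deflationConst L Δ k * s := by
    intro k
    induction k with
    | zero => intro _ i hi; omega
    | succ k ih =>
      intro hk i hi
      have ih' := ih (by omega)
      have hC := deflationConst_nonneg (L := L) hΔ k
      rw [deflationConst, add_mul]
      rcases Nat.lt_succ_iff_lt_or_eq.1 hi with h | rfl
      · have := ih' i h
        have : 0 ≤ (4 / Δ + (16 * L * k * deflationConst L Δ k / Δ) ^ 2 + 1) * s := by positivity
        linarith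
      · have := norm_sub_le_of_nearly_optimal_step hM hL hL0 hΔ hs hlam hgap hv hMv hquad hw hpos
          hopt hk hC ih'
        have : 0 ≤ deflationConst L Δ i * s := by positivity
        linarith
  exact fun k hk => key d le_rfl k hk

end Deflation

/-! ### The penalized matrix decomposition -/

section PMD

variable {n r d : ℕ}

theorem norm_toLp_sq {m : ℕ} (x : Fin m → ℝ) : ‖WithLp.toLp 2 x‖ ^ 2 = x ⬝ᵥ x := by
  rw [EuclideanSpace.norm_sq_eq]
  simp [dotProduct, sq]

theorem inner_toLp {m : ℕ} (x y : Fin m → ℝ) :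
    inner ℝ (WithLp.toLp 2 x) (WithLp.toLp 2 y) = x ⬝ᵥ y := by
  rw [EuclideanSpace.inner_toLp_toLp, dotProduct_comm]
  simp

theorem norm_toLp_le_one {m : ℕ} {x : Fin m → ℝ} (hx : x ⬝ᵥ x ≤ 1) : ‖WithLp.toLp 2 x‖ ≤ 1 := by
  rw [← norm_toLp_sq] at hx
  exact (sq_le_one_iff₀ (norm_nonneg _)).1 hx

/-- For a given `x` the best left vector is the normalized `A x`, so the left vector drops out and
`v₀` maximizes `‖A x‖`. Equality in Cauchy–Schwarz then makes `A v₀` a multiple of `u₀`. -/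
theorem eq_smul_and_le_of_maximizer {A : Matrix (Fin n) (Fin r) ℝ} {c : ℝ} {u₀ : Fin n → ℝ}
    {v₀ : Fin r → ℝ} (h₀ : (u₀, v₀) ∈ pmdFeasible n r c)
    (hmax : ∀ w ∈ pmdFeasible n r c, w.1 ⬝ᵥ (A *ᵥ w.2) ≤ u₀ ⬝ᵥ (A *ᵥ v₀)) :
    A *ᵥ v₀ = (u₀ ⬝ᵥ (A *ᵥ v₀)) • u₀ ∧
      ∀ x, l1Norm x ≤ c → x ⬝ᵥ x ≤ 1 → (A *ᵥ x) ⬝ᵥ (A *ᵥ x) ≤ (A *ᵥ v₀) ⬝ᵥ (A *ᵥ v₀) := by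
  obtain ⟨h1, h2, h3⟩ := h₀
  simp only at h1 h2 h3
  set m := u₀ ⬝ᵥ (A *ᵥ v₀) with hm
  have hm0 : 0 ≤ m := by
    -- The zero left vector is feasible and gives the value zero.
    have := hmax (0, v₀) ⟨h1, h2, by simp⟩
    simpa using this
  have hle : ∀ x, l1Norm x ≤ c → x ⬝ᵥ x ≤ 1 → (A *ᵥ x) ⬝ᵥ (A *ᵥ x) ≤ m ^ 2 := by
    intro x hx1 hx2
    set y := A *ᵥ x with hy
    have hy0 := dotProduct_self_nonneg y
    rcases hy0.eq_or_lt with h | h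
    · rw [← h]; positivity
    · obtain ⟨q, hq, hqq⟩ : ∃ q : ℝ, 0 < q ∧ q * q = y ⬝ᵥ y :=
        ⟨√(y ⬝ᵥ y), Real.sqrt_pos.2 h, Real.mul_self_sqrt hy0⟩
      have := hmax (q⁻¹ • y, x) ⟨hx1, hx2, by
        simp only [smul_dotProduct, dotProduct_smul, smul_eq_mul, ← hqq]
        refine le_of_eq ?_
        field_simp⟩
      simp only [smul_dotProduct, smul_eq_mul, ← hy, ← hqq] at this
      rw [inv_mul_cancel_left₀ hq.ne'] at this
      nlinarith
  have hself := hle v₀ h1 h2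
  have hres : (A *ᵥ v₀ - m • u₀) ⬝ᵥ (A *ᵥ v₀ - m • u₀) =
      (A *ᵥ v₀) ⬝ᵥ (A *ᵥ v₀) - 2 * m ^ 2 + m ^ 2 * (u₀ ⬝ᵥ u₀) := by
    simp only [sub_dotProduct, dotProduct_sub, smul_dotProduct, dotProduct_smul, smul_eq_mul]
    rw [dotProduct_comm (A *ᵥ v₀) u₀, ← hm]
    ring
  have hres0 := dotProduct_self_nonneg (A *ᵥ v₀ - m • u₀)
  have hu : m ^ 2 * (u₀ ⬝ᵥ u₀) ≤ m ^ 2 * 1 := mul_le_mul_of_nonneg_left h3 (sq_nonneg m)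
  refine ⟨sub_eq_zero.1 (dotProduct_self_eq_zero.1 (by linarith)), fun x hx1 hx2 => ?_⟩
  have := hle x hx1 hx2
  linarith

/-- Since `X^k v̂_k = σ̂_k û_k`, the subtracted term is `X^k v̂_k v̂_kᵀ`. This holds even if `v̂_k`
is shorter than a unit vector. -/
theorem deflated_mulVec {B : Matrix (Fin n) (Fin r) ℝ} {c : ℝ} {uhat : ℕ → Fin n → ℝ}
    {vhat : ℕ → Fin r → ℝ} (h : IsPMD B c d uhat vhat) {k : ℕ} (hk : k ≤ d) (x : Fin r → ℝ) :
    deflated B uhat vhat k *ᵥ x =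
      B *ᵥ (deflate (fun i => WithLp.toLp 2 (vhat i)) k (WithLp.toLp 2 x)).ofLp := by
  induction k generalizing x with
  | zero => rfl
  | succ k ih =>
    have hk' : k < d := hk
    obtain ⟨h1, -⟩ := eq_smul_and_le_of_maximizer (h k hk').1 (h k hk').2
    rw [deflated, Matrix.sub_mulVec, Matrix.smul_mulVec, vecMulVec_mulVec, deflate, inner_toLp,
      ← WithLp.toLp_smul, ← WithLp.toLp_sub, ← ih hk'.le, Matrix.mulVec_sub, Matrix.mulVec_smul]
    conv_rhs => rw [h1]
    congr 1
    ext i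
    simp
    ring

theorem l1Norm_nonneg {m : ℕ} (x : Fin m → ℝ) : 0 ≤ l1Norm x :=
  Finset.sum_nonneg fun _ _ => abs_nonneg _

theorem l1Norm_sub_smul_le {m : ℕ} (x y : Fin m → ℝ) (c : ℝ) :
    l1Norm (x - c • y) ≤ l1Norm x + |c| * l1Norm y := by
  have h : ∀ i, |(x - c • y) i| ≤ |x i| + |c| * |y i| := fun i => by
    rw [← abs_mul]
    exact norm_sub_le (x i) (c * y i)
  unfold l1Norm
  rw [Finset.mul_sum, ← Finset.sum_add_distrib]
  exact Finset.sum_le_sum fun i _ => h i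

/-- Each step subtracts a multiple of some `v̂_i` with coefficient at most one in absolute value. -/
theorem l1Norm_deflate_le {vhat : ℕ → Fin r → ℝ} {c : ℝ} {k : ℕ}
    (h1 : ∀ i < k, l1Norm (vhat i) ≤ c) (h2 : ∀ i < k, vhat i ⬝ᵥ vhat i ≤ 1) (x : Fin r → ℝ)
    (hx : ‖WithLp.toLp 2 x‖ ≤ 1) :
    l1Norm (deflate (fun i => WithLp.toLp 2 (vhat i)) k (WithLp.toLp 2 x)).ofLp ≤
      l1Norm x + k * c := by
  induction k generalizing x with
  | zero => simp [deflate]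
  | succ k ih =>
    have hk := k.lt_succ_self
    have hn := norm_toLp_le_one (h2 k hk)
    rw [deflate]
    have hle := norm_sub_inner_smul_le hn (WithLp.toLp 2 x)
    rw [inner_toLp, ← WithLp.toLp_smul, ← WithLp.toLp_sub] at hle ⊢
    have h3 := ih (fun i hi => h1 i (hi.trans hk)) (fun i hi => h2 i (hi.trans hk)) _
      (hle.trans hx)
    have h4 := l1Norm_sub_smul_le x (vhat k) (vhat k ⬝ᵥ x)
    have h5 : |vhat k ⬝ᵥ x| ≤ 1 := by
      rw [← inner_toLp]
      exact (abs_real_inner_le_norm _ _).trans (mul_le_one₀ hn (norm_nonneg _) hx)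
    have h6 := mul_le_mul h5 (h1 k hk) (l1Norm_nonneg _) zero_le_one
    push_cast
    linarith

theorem abs_dotProduct_mulVec_le {m q : ℕ} {E : Matrix (Fin m) (Fin q) ℝ} {ε : ℝ}
    (h : ∀ i j, |E i j| ≤ ε) (x : Fin m → ℝ) (y : Fin q → ℝ) :
    |x ⬝ᵥ (E *ᵥ y)| ≤ ε * (l1Norm x * l1Norm y) := by
  have h1 : ∀ i, |(E *ᵥ y) i| ≤ ε * l1Norm y := fun i => by
    unfold l1Norm
    rw [Finset.mul_sum]
    change |∑ j, E i j * y j| ≤ _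
    refine (Finset.abs_sum_le_sum_abs _ _).trans (Finset.sum_le_sum fun j _ => ?_)
    rw [abs_mul]
    exact mul_le_mul_of_nonneg_right (h i j) (abs_nonneg _)
  change |∑ i, x i * (E *ᵥ y) i| ≤ _
  refine (Finset.abs_sum_le_sum_abs _ _).trans ?_
  have : ε * (l1Norm x * l1Norm y) = ∑ i, |x i| * (ε * l1Norm y) := by
    rw [← Finset.sum_mul]; unfold l1Norm; ring
  rw [this]
  refine Finset.sum_le_sum fun i _ => ?_
  rw [abs_mul]
  exact mul_le_mul_of_nonneg_left (h1 i) (abs_nonneg _)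

theorem dotProduct_gram_mulVec (B : Matrix (Fin n) (Fin r) ℝ) (x : Fin r → ℝ) :
    x ⬝ᵥ (((n : ℝ)⁻¹ • (Bᵀ * B)) *ᵥ x) = (n : ℝ)⁻¹ * ((B *ᵥ x) ⬝ᵥ (B *ᵥ x)) := by
  rw [Matrix.smul_mulVec, dotProduct_smul, ← mulVec_mulVec, dotProduct_mulVec x Bᵀ,
    vecMul_transpose, smul_eq_mul]

theorem IsPMD.exists_sign_close {M : Matrix (Fin r) (Fin r) ℝ} {hM : M.IsHermitian}
    {V : Fin d → Fin r → ℝ} (hV : IsLeadingEigenvectors hM V) {Δ L ε τ : ℝ} (hΔ : 0 < Δ)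
    (hgap : ∀ j < d, Δ ≤ sortedEigenvalue hM j - sortedEigenvalue hM (j + 1))
    (hpos : ∀ x, 0 ≤ x ⬝ᵥ (M *ᵥ x)) (hL0 : 0 ≤ L)
    (hL : ∀ x, (M *ᵥ x) ⬝ᵥ (M *ᵥ x) ≤ L ^ 2 * (x ⬝ᵥ x))
    {B : Matrix (Fin n) (Fin r) ℝ} (hε0 : 0 ≤ ε)
    (hε : ∀ i j, |((n : ℝ)⁻¹ • (Bᵀ * B)) i j - M i j| ≤ ε) (hτ : ∀ j, l1Norm (V j) ≤ τ)
    {uhat : ℕ → Fin n → ℝ} {vhat : ℕ → Fin r → ℝ} (hpmd : IsPMD B τ d uhat vhat) :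
    ∃ sgn : Fin d → ℝ, (∀ j, sgn j = 1 ∨ sgn j = -1) ∧ ∀ j : Fin d,
      ‖WithLp.toLp 2 (vhat j - sgn j • V j)‖ ≤
        deflationConst L Δ d * √(2 * (d + 1) ^ 2 * (τ ^ 2 * ε)) := by
  -- Eigenvectors are determined up to sign; this choice makes the inner products with the `v̂_j`
  -- nonnegative.
  set sgn : Fin d → ℝ := fun j => if 0 ≤ V j ⬝ᵥ vhat j then 1 else -1 with hsgn
  have hs1 : ∀ j, sgn j = 1 ∨ sgn j = -1 := fun j => by
    simp only [hsgn]; split_ifs <;> simp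
  have hs2 : ∀ j, sgn j * sgn j = 1 := fun j => by
    rcases hs1 j with h | h <;> rw [h] <;> norm_num
  refine ⟨sgn, hs1, ?_⟩
  set w : ℕ → EuclideanSpace ℝ (Fin r) := fun i => WithLp.toLp 2 (vhat i) with hw
  set v : ℕ → EuclideanSpace ℝ (Fin r) :=
    fun i => if h : i < d then WithLp.toLp 2 (sgn ⟨i, h⟩ • V ⟨i, h⟩) else 0 with hv
  have hvi : ∀ i (h : i < d), v i = WithLp.toLp 2 (sgn ⟨i, h⟩ • V ⟨i, h⟩) := fun i h => dif_pos h
  set M' : EuclideanSpace ℝ (Fin r) →ₗ[ℝ] EuclideanSpace ℝ (Fin r) := toEuclideanLin M with hM'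
  have hMx : ∀ x : EuclideanSpace ℝ (Fin r), M' x = WithLp.toLp 2 (M *ᵥ x.ofLp) := fun x => rfl
  have hin : ∀ x y : EuclideanSpace ℝ (Fin r), inner ℝ x y = x.ofLp ⬝ᵥ y.ofLp :=
    fun x y => inner_toLp x.ofLp y.ofLp
  have hnsq : ∀ x : EuclideanSpace ℝ (Fin r), ‖x‖ ^ 2 = x.ofLp ⬝ᵥ x.ofLp :=
    fun x => norm_toLp_sq x.ofLp
  have hfeas : ∀ k < d, l1Norm (vhat k) ≤ τ ∧ vhat k ⬝ᵥ vhat k ≤ 1 := fun k hk =>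
    ⟨(hpmd k hk).1.1, (hpmd k hk).1.2.1⟩
  have hlV : ∀ j, l1Norm (sgn j • V j) ≤ τ := fun j => by
    refine le_of_eq_of_le ?_ (hτ j)
    unfold l1Norm
    refine Finset.sum_congr rfl fun i _ => ?_
    rw [Pi.smul_apply, smul_eq_mul, abs_mul]
    rcases hs1 j with h | h <;> rw [h] <;> simp
  have hVV : ∀ i j, (sgn i • V i) ⬝ᵥ (sgn j • V j) = if i = j then (1 : ℝ) else 0 := fun i j => by
    rw [smul_dotProduct, dotProduct_smul, hV.orthonormal, smul_eq_mul, smul_eq_mul]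
    split_ifs with h
    · subst h; rw [mul_one, hs2]
    · simp
  have hquadbound : ∀ k < d, ∀ x : Fin r → ℝ, l1Norm x ≤ τ → x ⬝ᵥ x ≤ 1 →
      |(n : ℝ)⁻¹ * ((deflated B uhat vhat k *ᵥ x) ⬝ᵥ (deflated B uhat vhat k *ᵥ x)) -
        inner ℝ (deflate w k (WithLp.toLp 2 x)) (M' (deflate w k (WithLp.toLp 2 x)))| ≤
      (d + 1) ^ 2 * (τ ^ 2 * ε) := by
    intro k hk x hx1 hx2
    set y := (deflate w k (WithLp.toLp 2 x)).ofLp with hy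
    have hyl : l1Norm y ≤ (d + 1) * τ := by
      have := l1Norm_deflate_le (k := k) (fun i hi => (hfeas i (hi.trans hk)).1)
        (fun i hi => (hfeas i (hi.trans hk)).2) x (norm_toLp_le_one hx2)
      have hτ0 : 0 ≤ τ := (l1Norm_nonneg _).trans hx1
      have hkd : (k : ℝ) ≤ d := by exact_mod_cast hk.le
      have := mul_le_mul_of_nonneg_right hkd hτ0
      linarith
    rw [deflated_mulVec hpmd hk.le, hin, hMx, ← dotProduct_gram_mulVec, ← dotProduct_sub,
      ← Matrix.sub_mulVec]
    refine (abs_dotProduct_mulVec_le (ε := ε) (fun i j => hε i j) y y).trans ?_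
    have := mul_le_mul hyl hyl (l1Norm_nonneg y) ((l1Norm_nonneg y).trans hyl)
    have := mul_le_mul_of_nonneg_left this hε0
    linarith
  -- The factor `2` counts the replacement of the sample covariance twice, at `v̂_k` and at its
  -- competitor, the signed eigenvector. The latter is feasible because `τ` bounds its ℓ₁ norm.
  have hs0 : 0 ≤ 2 * ((d : ℝ) + 1) ^ 2 * (τ ^ 2 * ε) := by positivity
  have main := norm_sub_le_of_nearly_optimal (M := M') (L := L) (Δ := Δ)
    (s := √(2 * (d + 1) ^ 2 * (τ ^ 2 * ε))) (d := d) (v := v) (w := w)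
    (lam := sortedEigenvalue hM)
    (fun x y => by
      rw [hin, hin, hMx, hMx]
      exact mulVec_dotProduct_of_isHermitian hM _ _)
    (fun x => by
      refine (sq_le_sq₀ (norm_nonneg _) (by positivity)).1 ?_
      rw [mul_pow, hnsq, hnsq, hMx]
      exact hL _)
    hL0 hΔ (Real.sqrt_nonneg _) (sortedEigenvalue_nonneg hM hpos) hgap
    (fun i hi j hj => by
      rw [hvi i hi, hvi j hj, inner_toLp, hVV]
      simp [Fin.ext_iff])
    (fun k hk => by
      rw [hvi k hk, hMx, ← WithLp.toLp_smul]
      congr 1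
      show M *ᵥ (sgn ⟨k, hk⟩ • V ⟨k, hk⟩) = _
      rw [mulVec_smul, hV.eigenvector, smul_comm])
    (fun k hk y hy => by
      have hc : ∀ i (hi : i < d), inner ℝ (v i) y = sgn ⟨i, hi⟩ * (V ⟨i, hi⟩ ⬝ᵥ y.ofLp) :=
        fun i hi => by
          rw [hvi i hi, hin]
          show (sgn ⟨i, hi⟩ • V ⟨i, hi⟩) ⬝ᵥ y.ofLp = _
          rw [smul_dotProduct, smul_eq_mul]
      have := hV.quadratic_form_le hM hΔ hgap ⟨k, hk⟩ (y := y.ofLp) fun i hi => by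
        have h1 := hy i hi
        rw [hc i i.2] at h1
        rcases mul_eq_zero.1 h1 with h2 | h2
        · have := hs2 i
          rw [h2] at this
          norm_num at this
        · exact h2
      have hsq : inner ℝ (v k) y ^ 2 = (V ⟨k, hk⟩ ⬝ᵥ y.ofLp) ^ 2 := by
        rw [hc k hk]
        linear_combination (V ⟨k, hk⟩ ⬝ᵥ y.ofLp) ^ 2 * hs2 ⟨k, hk⟩
      rw [hsq, hin, hMx, hnsq]
      exact this)
    (fun k hk => norm_toLp_le_one (hfeas k hk).2)
    (fun k hk => by
      rw [hvi k hk, inner_toLp, smul_dotProduct, smul_eq_mul]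
      simp only [hsgn]
      split_ifs with h
      · simpa using h
      · simp only [not_le] at h
        linarith)
    (fun k hk => by
      rw [Real.sq_sqrt hs0]
      have h1 := hquadbound k hk _ (hfeas k hk).1 (hfeas k hk).2
      have h2 := hquadbound k hk _ (hlV ⟨k, hk⟩) (by rw [hVV, if_pos rfl])
      rw [← hvi k hk] at h2
      have h3 := (eq_smul_and_le_of_maximizer (hpmd k hk).1 (hpmd k hk).2).2 _ (hlV ⟨k, hk⟩)
        (by rw [hVV, if_pos rfl])
      have h4 := mul_le_mul_of_nonneg_left h3 (inv_nonneg.2 (Nat.cast_nonneg (α := ℝ) n))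
      have h5 := (abs_le.1 h1).2
      have h6 := (abs_le.1 h2).1
      linarith)
  intro j
  have := main j j.2
  rwa [hvi j j.2, hw, ← WithLp.toLp_sub] at this

end PMD

/-! ### Deterministic error bound for the sparse NIECE estimator -/

section Deterministic

theorem norm_toLp_mulVec_le {m q : ℕ} {E : Matrix (Fin m) (Fin q) ℝ} {ε : ℝ}
    (h : ∀ i j, |E i j| ≤ ε) (x : Fin q → ℝ) :
    ‖WithLp.toLp 2 (E *ᵥ x)‖ ^ 2 ≤ m * (ε * l1Norm x) ^ 2 := by
  have h1 : ∀ i, (E *ᵥ x) i * (E *ᵥ x) i ≤ (ε * l1Norm x) ^ 2 := fun i => by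
    have h2 := abs_dotProduct_mulVec_le h (Pi.single i 1) x
    have h3 : l1Norm (Pi.single i 1 : Fin m → ℝ) = 1 := by
      unfold l1Norm
      rw [Finset.sum_eq_single i (fun j _ hj => by simp [hj]) (by simp)]
      simp
    rw [single_one_dotProduct, h3, one_mul] at h2
    rw [← sq, ← sq_abs]
    exact pow_le_pow_left₀ (abs_nonneg _) h2 2
  rw [norm_toLp_sq]
  refine (Finset.sum_le_sum fun i _ => h1 i).trans ?_
  simp

theorem abs_norm_sq_sub_norm_sq_le {H : Type*} [NormedAddCommGroup H] {a b : H} {e K : ℝ}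
    (h : ‖a - b‖ ≤ e) (hb : ‖b‖ ≤ K) : |‖a‖ ^ 2 - ‖b‖ ^ 2| ≤ e * (e + 2 * K) := by
  have h1 : |‖a‖ - ‖b‖| ≤ e := (abs_norm_sub_norm_le a b).trans h
  have h2 : ‖a‖ ^ 2 - ‖b‖ ^ 2 = (‖a‖ - ‖b‖) * (‖a‖ + ‖b‖) := by ring
  have h3 := (abs_le.1 h1).2
  rw [h2, abs_mul, abs_of_nonneg (by positivity : 0 ≤ ‖a‖ + ‖b‖)]
  exact mul_le_mul h1 (by linarith) (by positivity) ((abs_nonneg _).trans h1)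

/-- Positivity makes the inverse gap in the growth condition a genuine inverse and not the default
zero. -/
theorem scoreGap_pos {p r d : ℕ} {M : Matrix (Fin r) (Fin r) ℝ} {hM : M.IsHermitian}
    (S : Matrix (Fin p) (Fin r) ℝ) {V : Fin d → Fin r → ℝ} (hV : IsLeadingEigenvectors hM V)
    {Δ : ℝ} (hΔ : 0 < Δ)
    (hgap : ∀ j < d, Δ ≤ sortedEigenvalue hM j - sortedEigenvalue hM (j + 1))
    (henv : envelope M (Sᵀ * S) ≤ Submodule.span ℝ (Set.range V)) {u : ℕ} (hu : 1 ≤ u)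
    (hdim : Module.finrank ℝ (envelope M (Sᵀ * S)) = u) : 0 < scoreGap (Sᵀ * S) V u := by
  refine (nthLargest_gap (fun j => ?_) hu ?_).1
  · rw [envelopeScore_gram]
    exact dotProduct_self_nonneg _
  · rw [← hdim, envelope_eq_span hV hΔ hgap S henv, finrank_span_image_orthonormal hV.orthonormal]

/-- The constant is chosen before the dimensions and matrices, so one `C` serves the whole sequence
of problems. -/
theorem exists_sparseNIECE_bound (d : ℕ) {L Δ κ : ℝ} (hL0 : 0 ≤ L) (hΔ : 0 < Δ) (hκ : 0 ≤ κ) :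
    ∃ C : ℝ, 0 ≤ C ∧ ∀ {n p r : ℕ} {M : Matrix (Fin r) (Fin r) ℝ} (hM : M.IsHermitian)
      (S : Matrix (Fin p) (Fin r) ℝ) {V : Fin d → Fin r → ℝ} (_ : IsLeadingEigenvectors hM V)
      (_ : ∀ j < d, Δ ≤ sortedEigenvalue hM j - sortedEigenvalue hM (j + 1))
      (_ : ∀ x, 0 ≤ x ⬝ᵥ (M *ᵥ x))
      (_ : ∀ x, (M *ᵥ x) ⬝ᵥ (M *ᵥ x) ≤ L ^ 2 * (x ⬝ᵥ x))
      (_ : ∀ x, (S *ᵥ x) ⬝ᵥ (S *ᵥ x) ≤ L ^ 2 * (x ⬝ᵥ x))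
      (_ : envelope M (Sᵀ * S) ≤ Submodule.span ℝ (Set.range V)) {u : ℕ} (_ : 1 ≤ u)
      (_ : Module.finrank ℝ (envelope M (Sᵀ * S)) = u) {τ : ℝ} (_ : ∀ j, l1Norm (V j) ≤ τ)
      {A : Matrix (Fin n) (Fin p) ℝ} {B : Matrix (Fin n) (Fin r) ℝ} {ε : ℝ} (_ : 0 ≤ ε)
      (_ : ∀ i j, |sampleCrossCov B B i j - M i j| ≤ ε)
      (_ : ∀ i j, |sampleCrossCov A B i j - S i j| ≤ ε) (_ : p * ε ≤ κ)
      (_ : τ ^ 2 * ε ≤ 1) (_ : C * √(τ ^ 2 * ε) < scoreGap (Sᵀ * S) V u)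
      {K : Submodule ℝ (Fin r → ℝ)} (_ : IsSparseNIECE A B τ d u K),
      frobNorm (projMatrix K - projMatrix (envelope M (Sᵀ * S))) ^ 2 ≤ C * (τ ^ 2 * ε) := by
  set C₀ := deflationConst L Δ d * √(2 * ((d : ℝ) + 1) ^ 2) with hC₀
  have hC₀0 : 0 ≤ C₀ := mul_nonneg (deflationConst_nonneg hΔ d) (Real.sqrt_nonneg _)
  set C₁ := √κ + L * C₀ with hC₁
  have hC₁0 : 0 ≤ C₁ := by positivity
  -- `C₀ √ρ` bounds the error of a direction and `C₁ √ρ` that of its image under the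
  -- cross-covariance. The first summand makes score errors less than half the gap; the second
  -- bounds the projection error.
  refine ⟨2 * (C₁ * (C₁ + 2 * L)) + 2 * d * C₀ ^ 2, by positivity, ?_⟩
  intro n p r M hM S V hV hgap hpos hLM hLS henv u hu hdim τ hτ A B ε hε0 hεM hεS hpε hρ1 hC K hK
  set ρ := τ ^ 2 * ε with hρ
  have hρ0 : 0 ≤ ρ := by positivity
  have hsρ0 : 0 ≤ √ρ := Real.sqrt_nonneg _
  have hsρ1 : √ρ ≤ 1 := Real.sqrt_le_one.2 hρ1
  set φ := envelopeScore (Sᵀ * S) V with hφdef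
  have hφ : ∀ j, 0 ≤ φ j := fun j => by
    rw [hφdef, envelopeScore_gram]
    exact dotProduct_self_nonneg _
  have hE := envelope_eq_span hV hΔ hgap S henv
  set I : Finset (Fin d) := Finset.univ.filter fun j => 0 < φ j with hI
  have hcard : I.card = u := by
    rw [← hdim, hE, finrank_span_image_orthonormal hV.orthonormal]
  have hgapφ := (nthLargest_gap hφ hu hcard).2
  obtain ⟨uhat, vhat, π, hpmd, hanti, rfl⟩ := hK
  obtain ⟨sgn, hsgn, hclose⟩ := hpmd.exists_sign_close hV hΔ hgap hpos hL0 hLM hε0 hεM hτ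
  rw [Real.sqrt_mul (by positivity), ← mul_assoc, ← hC₀, ← hρ] at hclose
  have hfeas : ∀ j : Fin d, l1Norm (vhat j) ≤ τ := fun j => (hpmd j j.2).1.1
  have hsV : ∀ j : Fin d, (S *ᵥ (sgn j • V j)) ⬝ᵥ (S *ᵥ (sgn j • V j)) = φ j := fun j => by
    rw [hφdef, envelopeScore_gram, mulVec_smul, smul_dotProduct, dotProduct_smul]
    rcases hsgn j with h | h <;> rw [h] <;> simp
  have hsum : ∀ j : Fin d, |envelopeScore (sampleU A B) (fun i : Fin d => vhat i) j - φ j| ≤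
      C₁ * (C₁ + 2 * L) * √ρ := by
    intro j
    have hφL : ‖WithLp.toLp 2 (S *ᵥ (sgn j • V j))‖ ≤ L := by
      refine (sq_le_sq₀ (norm_nonneg _) hL0).1 ?_
      have h1 := hLS (V j)
      rw [hV.orthonormal, if_pos rfl, mul_one] at h1
      rw [norm_toLp_sq, hsV, hφdef, envelopeScore_gram]
      exact h1
    -- The image has `p` coordinates, each at most `ε τ`, and `p (ε τ)² = (p ε) ρ`. This is where
    -- boundedness of `p ε` enters.
    have h1 : ‖WithLp.toLp 2 ((sampleCrossCov A B - S) *ᵥ vhat j)‖ ≤ √κ * √ρ := by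
      refine (sq_le_sq₀ (norm_nonneg _) (by positivity)).1 ?_
      rw [mul_pow, Real.sq_sqrt hκ, Real.sq_sqrt hρ0]
      refine (norm_toLp_mulVec_le (ε := ε) (fun i k => hεS i k) _).trans ?_
      have h2 := pow_le_pow_left₀ (l1Norm_nonneg _) (hfeas j) 2
      have h3 := mul_le_mul hpε (mul_le_mul_of_nonneg_right h2 hε0) (by positivity) hκ
      calc (p : ℝ) * (ε * l1Norm (vhat j)) ^ 2 = p * ε * (l1Norm (vhat j) ^ 2 * ε) := by ring
        _ ≤ κ * ρ := h3
    have h2 : ‖WithLp.toLp 2 (S *ᵥ (vhat j - sgn j • V j))‖ ≤ L * (C₀ * √ρ) := by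
      refine le_trans ?_ (mul_le_mul_of_nonneg_left (hclose j) hL0)
      refine (sq_le_sq₀ (norm_nonneg _) (by positivity)).1 ?_
      rw [mul_pow, norm_toLp_sq, norm_toLp_sq]
      exact hLS _
    have h3 : ‖WithLp.toLp 2 (sampleCrossCov A B *ᵥ vhat j) -
        WithLp.toLp 2 (S *ᵥ (sgn j • V j))‖ ≤ C₁ * √ρ := by
      have : WithLp.toLp 2 (sampleCrossCov A B *ᵥ vhat j) -
          WithLp.toLp 2 (S *ᵥ (sgn j • V j)) =
          WithLp.toLp 2 ((sampleCrossCov A B - S) *ᵥ vhat j) +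
          WithLp.toLp 2 (S *ᵥ (vhat j - sgn j • V j)) := by
        rw [← WithLp.toLp_sub, ← WithLp.toLp_add, Matrix.sub_mulVec, Matrix.mulVec_sub]
        congr 1
        abel
      rw [this]
      refine (norm_add_le _ _).trans ?_
      rw [hC₁, add_mul]
      linarith
    have h4 := abs_norm_sq_sub_norm_sq_le h3 hφL
    rw [norm_toLp_sq, norm_toLp_sq, hsV, ← envelopeScore_gram _ (fun i : Fin d => vhat i)] at h4
    refine h4.trans ?_
    have h5 : C₁ * √ρ ≤ C₁ * 1 := mul_le_mul_of_nonneg_left hsρ1 hC₁0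
    have h6 : 0 ≤ C₁ * √ρ := by positivity
    have := mul_le_mul_of_nonneg_left (add_le_add_left h5 (2 * L)) h6
    linarith
  have hrank := pos_iff_rank_lt hφ hcard hgapφ
    (ψ := envelopeScore (sampleU A B) (fun i : Fin d => vhat i))
    (fun j => lt_of_le_of_lt (hsum j) (by
      have h1 : (2 * (C₁ * (C₁ + 2 * L)) + 2 * d * C₀ ^ 2) * √ρ <
        nthLargest φ (u - 1) - nthLargest φ u := hC
      have h2 : 0 ≤ 2 * d * C₀ ^ 2 * √ρ := by positivity
      linarith)) hanti
  have hset : {x | ∃ j : Fin d, (j : ℕ) < u ∧ x = vhat (π j)} =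
      ((I.image fun j : Fin d => vhat j : Finset (Fin r → ℝ)) : Set (Fin r → ℝ)) := by
    ext x
    simp only [Set.mem_ofPred_eq, Finset.coe_image, Set.mem_image, Finset.mem_coe]
    constructor
    · rintro ⟨j, hj, rfl⟩
      exact ⟨π j, by simpa [hI] using (hrank j).2 hj, rfl⟩
    · rintro ⟨i, hi, rfl⟩
      obtain ⟨j, rfl⟩ := π.surjective i
      exact ⟨j, (hrank j).1 (by simpa [hI] using hi), rfl⟩
  rw [hset, hE]
  -- The rank bound survives coinciding or dependent `v̂_j`, since a span has dimension at most the
  -- number of its generators.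
  refine (frobNorm_projMatrix_sub_sq_le _ (w := fun j => sgn j • vhat j) hV.orthonormal I
    (fun j hj => Submodule.smul_mem _ _ (Submodule.subset_span ?_))
    ((finrank_span_finset_le_card _).trans Finset.card_image_le)).trans ?_
  · rw [Finset.coe_image]
    exact ⟨j, hj, rfl⟩
  have hterm : ∀ j ∈ I, (V j - sgn j • vhat j) ⬝ᵥ (V j - sgn j • vhat j) ≤ C₀ ^ 2 * ρ := by
    intro j _
    have h1 : (V j - sgn j • vhat j) ⬝ᵥ (V j - sgn j • vhat j) =
        (vhat j - sgn j • V j) ⬝ᵥ (vhat j - sgn j • V j) := by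
      simp only [sub_dotProduct, dotProduct_sub, smul_dotProduct, dotProduct_smul, smul_eq_mul]
      rw [dotProduct_comm (V j) (vhat j)]
      rcases hsgn j with h | h <;> rw [h] <;> ring
    rw [h1, ← norm_toLp_sq]
    refine (pow_le_pow_left₀ (norm_nonneg _) (hclose j) 2).trans_eq ?_
    rw [mul_pow, Real.sq_sqrt hρ0]
  have h2 := Finset.sum_le_card_nsmul I _ _ hterm
  have h3 : (I.card : ℝ) ≤ d := by
    have := Finset.card_le_univ I
    rw [Fintype.card_fin] at this
    exact_mod_cast this
  rw [nsmul_eq_mul] at h2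
  have h4 := mul_le_mul_of_nonneg_right h3 (by positivity : 0 ≤ C₀ ^ 2 * ρ)
  have h5 : 0 ≤ 2 * (C₁ * (C₁ + 2 * L)) * ρ := by positivity
  linarith

end Deterministic

/-! ### Sub-exponential variables and concentration of sample means -/

section Concentration

variable {Ω : Type*} [MeasurableSpace Ω] {P : Measure Ω}

/-- The exponential moment of `|S|` at `a` is at most `3`. -/
structure HasExpMoment (P : Measure Ω) (a : ℝ) (S : Ω → ℝ) : Prop where
  aemeasurable : AEMeasurable S P
  integrable : Integrable (fun ω => Real.exp (a * |S ω|)) P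
  le_three : ∫ ω, Real.exp (a * |S ω|) ∂P ≤ 3

theorem HasExpMoment.of_le [IsProbabilityMeasure P] {a : ℝ} {S T : Ω → ℝ}
    (hS : AEMeasurable S P) (hT : Integrable T P) (h : ∀ ω, Real.exp (a * |S ω|) ≤ T ω)
    (h3 : ∫ ω, T ω ∂P ≤ 3) : HasExpMoment P a S := by
  have hint : Integrable (fun ω => Real.exp (a * |S ω|)) P := by
    refine hT.mono' ?_ (ae_of_all _ fun ω => ?_)
    · exact (Real.measurable_exp.comp_aemeasurable
        ((measurable_norm.comp_aemeasurable hS).const_mul a)).aestronglyMeasurable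
    · rw [Real.norm_eq_abs, Real.abs_exp]
      exact h ω
  exact ⟨hS, hint, (integral_mono hint hT h).trans h3⟩

theorem HasExpMoment.const_one [IsProbabilityMeasure P] {a : ℝ} (ha : a ≤ 1) :
    HasExpMoment P a fun _ => (1 : ℝ) := by
  refine HasExpMoment.of_le aemeasurable_const (integrable_const (3 : ℝ)) (fun ω => ?_)
    (by simp)
  rw [abs_one, mul_one]
  exact (Real.exp_le_exp.2 ha).trans Real.exp_one_lt_three.le

theorem HasExpMoment.neg {a : ℝ} {S : Ω → ℝ} (h : HasExpMoment P a S) :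
    HasExpMoment P a fun ω => -S ω :=
  ⟨h.aemeasurable.neg, by simpa using h.integrable, by simpa using h.le_three⟩

/-- Use `|A B| ≤ (A² + B²) / 2` and convexity of the exponential. -/
theorem HasExpMoment.mul [IsProbabilityMeasure P] {a : ℝ} (ha : 0 ≤ a) {A B : Ω → ℝ}
    (hA : AEMeasurable A P) (hB : AEMeasurable B P)
    (hA2 : HasExpMoment P a fun ω => A ω ^ 2) (hB2 : HasExpMoment P a fun ω => B ω ^ 2) :
    HasExpMoment P a fun ω => A ω * B ω := by
  refine HasExpMoment.of_le (hA.mul hB) ((hA2.integrable.add hB2.integrable).div_const 2)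
    (fun ω => ?_) ?_
  · have hmid : a * |A ω * B ω| ≤ (a * |A ω ^ 2| + a * |B ω ^ 2|) / 2 := by
      have : |A ω * B ω| ≤ (|A ω ^ 2| + |B ω ^ 2|) / 2 := by
        rw [abs_mul, abs_pow, abs_pow]
        nlinarith [sq_nonneg (|A ω| - |B ω|)]
      have := mul_le_mul_of_nonneg_left this ha
      linarith
    have hconv : ∀ x y : ℝ, Real.exp ((x + y) / 2) ≤ (Real.exp x + Real.exp y) / 2 := fun x y => by
      have hx : Real.exp x = Real.exp (x / 2) ^ 2 := by
        rw [← Real.exp_nat_mul]; congr 1; push_cast; ring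
      have hy : Real.exp y = Real.exp (y / 2) ^ 2 := by
        rw [← Real.exp_nat_mul]; congr 1; push_cast; ring
      rw [add_div, Real.exp_add, hx, hy]
      nlinarith [sq_nonneg (Real.exp (x / 2) - Real.exp (y / 2))]
    exact (Real.exp_le_exp.2 hmid).trans (hconv _ _)
  · have := integral_add hA2.integrable hB2.integrable
    simp only [Pi.add_apply]
    rw [integral_div, this]
    have := hA2.le_three
    have := hB2.le_three
    linarith

theorem HasExpMoment.integrable_self {a : ℝ} (ha : 0 < a) {S : Ω → ℝ}
    (h : HasExpMoment P a S) : Integrable S P := by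
  refine (h.integrable.const_mul a⁻¹).mono' h.aemeasurable.aestronglyMeasurable
    (ae_of_all _ fun ω => ?_)
  rw [Real.norm_eq_abs, ← div_eq_inv_mul, le_div_iff₀ ha]
  have := Real.add_one_le_exp (a * |S ω|)
  linarith

theorem HasExpMoment.integral_abs_le {a : ℝ} (ha : 0 < a) {S : Ω → ℝ}
    (h : HasExpMoment P a S) : ∫ ω, |S ω| ∂P ≤ 3 / a := by
  rw [le_div_iff₀ ha, ← integral_mul_const]
  refine (integral_mono ((h.integrable_self ha).abs.mul_const a) h.integrable fun ω => ?_).trans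
    h.le_three
  have := Real.add_one_le_exp (a * |S ω|)
  simp only
  linarith

/-- A sub-Gaussian tail bound controls an exponential moment of the square. -/
theorem HasExpMoment.sq_of_tail [IsProbabilityMeasure P] {σ : ℝ} (hσ : 0 < σ) {W : Ω → ℝ}
    (hW : AEMeasurable W P)
    (htail : ∀ t, 0 ≤ t → P.real {ω | t ≤ |W ω|} ≤ 2 * Real.exp (-(t ^ 2 / σ ^ 2))) :
    HasExpMoment P (1 / (2 * σ ^ 2)) fun ω => W ω ^ 2 := by
  set a := 1 / (2 * σ ^ 2) with ha
  have ha0 : 0 < a := by positivity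
  have hcont : Continuous fun t : ℝ => a * Real.exp (a * t) := by fun_prop
  have hprim : ∀ y : ℝ, ∫ t in (0 : ℝ)..y, a * Real.exp (a * t) = Real.exp (a * y) - 1 := by
    intro y
    have hd : ∀ t ∈ Set.uIcc 0 y, HasDerivAt (fun t => Real.exp (a * t)) (a * Real.exp (a * t)) t := by
      intro t _
      have := ((hasDerivAt_id t).const_mul a).exp
      simpa [mul_comm] using this
    rw [intervalIntegral.integral_eq_sub_of_hasDerivAt hd (hcont.intervalIntegrable _ _)]
    simp
  have hW2 : AEMeasurable (fun ω => W ω ^ 2) P := hW.pow_const 2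
  have hcake := lintegral_comp_eq_lintegral_meas_le_mul (g := fun t => a * Real.exp (a * t)) P
    (ae_of_all _ fun ω => sq_nonneg (W ω)) hW2 (fun t _ => hcont.intervalIntegrable _ _)
    (ae_of_all _ fun t => by positivity)
  -- Layer cake: the tail of `W²` is at most `2 exp (-2 a t)`, the weight is `a exp (a t)`, and the
  -- product `2 a exp (-a t)` integrates to `2`.
  have hbound : ∫⁻ ω, ENNReal.ofReal (Real.exp (a * W ω ^ 2) - 1) ∂P ≤ ENNReal.ofReal 2 := by
    simp only [hprim] at hcake
    rw [hcake]
    have hneg : -a < 0 := by linarith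
    have hval : ∫ t in Set.Ioi (0 : ℝ), 2 * a * Real.exp (-a * t) = 2 := by
      rw [integral_const_mul, integral_exp_mul_Ioi hneg]
      rw [mul_zero, Real.exp_zero]
      field_simp
    rw [← hval, ofReal_integral_eq_lintegral_ofReal
      ((integrableOn_exp_mul_Ioi hneg 0).const_mul _) (ae_of_all _ fun t => by positivity)]
    refine setLIntegral_mono (by fun_prop) fun t ht => ?_
    have ht0 : 0 ≤ t := le_of_lt ht
    have hset : {ω | t ≤ W ω ^ 2} = {ω | √t ≤ |W ω|} := by
      ext ω
      rw [Set.mem_ofPred_eq, Set.mem_ofPred_eq, ← sq_abs, Real.sqrt_le_left (abs_nonneg _)]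
    have hP : P {ω | t ≤ W ω ^ 2} ≤ ENNReal.ofReal (2 * Real.exp (-(t / σ ^ 2))) := by
      rw [hset, ← ofReal_measureReal]
      refine ENNReal.ofReal_le_ofReal ((htail _ (Real.sqrt_nonneg t)).trans_eq ?_)
      rw [Real.sq_sqrt ht0]
    refine (mul_le_mul_left hP _).trans_eq ?_
    rw [← ENNReal.ofReal_mul (by positivity)]
    congr 1
    have : Real.exp (-a * t) = Real.exp (-(t / σ ^ 2)) * Real.exp (a * t) := by
      rw [← Real.exp_add]
      congr 1
      rw [ha]
      field_simp
      ring
    rw [this]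
    ring
  have hmeas : AEStronglyMeasurable (fun ω => Real.exp (a * W ω ^ 2) - 1) P :=
    ((Real.measurable_exp.comp_aemeasurable (hW2.const_mul a)).sub_const 1).aestronglyMeasurable
  have hnn : ∀ ω, 0 ≤ Real.exp (a * W ω ^ 2) - 1 := fun ω => by
    have := Real.one_le_exp (by positivity : 0 ≤ a * W ω ^ 2)
    linarith
  have hint : Integrable (fun ω => Real.exp (a * W ω ^ 2) - 1) P := by
    refine ⟨hmeas, ?_⟩
    rw [hasFiniteIntegral_iff_ofReal (ae_of_all _ hnn)]
    exact hbound.trans_lt ENNReal.ofReal_lt_top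
  have hle : ∫ ω, (Real.exp (a * W ω ^ 2) - 1) ∂P ≤ 2 := by
    rw [integral_eq_lintegral_of_nonneg_ae (ae_of_all _ hnn) hmeas]
    exact ENNReal.toReal_le_of_le_ofReal (by norm_num) hbound
  refine HasExpMoment.of_le hW2 (T := fun ω => (Real.exp (a * W ω ^ 2) - 1) + 1)
    (hint.add (integrable_const 1)) (fun ω => ?_) ?_
  · rw [abs_of_nonneg (sq_nonneg (W ω)), sub_add_cancel]
  · rw [integral_add hint (integrable_const 1)]
    simp only [integral_const, probReal_univ, smul_eq_mul, mul_one]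
    linarith

theorem exp_le_one_add_add (x : ℝ) : Real.exp x ≤ 1 + x + x ^ 2 * Real.exp |x| := by
  have h := Complex.norm_exp_sub_sum_le_norm_mul_exp (x : ℂ) 2
  have h2 : Complex.exp x - ∑ m ∈ Finset.range 2, (x : ℂ) ^ m / (m.factorial : ℂ) =
      ((Real.exp x - (1 + x) : ℝ) : ℂ) := by
    simp [Finset.sum_range_succ]
  rw [h2, Complex.norm_real, Complex.norm_real, Real.norm_eq_abs, Real.norm_eq_abs, sq_abs] at h
  have := (abs_le.1 h).2
  linarith

theorem HasExpMoment.integrable_exp_mul [IsProbabilityMeasure P] {a : ℝ} {S : Ω → ℝ}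
    (h : HasExpMoment P a S) {lam : ℝ} (hlam : |lam| ≤ a) :
    Integrable (fun ω => Real.exp (lam * S ω)) P := by
  refine h.integrable.mono' (Real.measurable_exp.comp_aemeasurable
    (h.aemeasurable.const_mul lam)).aestronglyMeasurable (ae_of_all _ fun ω => ?_)
  rw [Real.norm_eq_abs, Real.abs_exp, Real.exp_le_exp]
  refine (le_abs_self _).trans ?_
  rw [abs_mul]
  exact mul_le_mul_of_nonneg_right hlam (abs_nonneg _)

theorem HasExpMoment.mgf_le [IsProbabilityMeasure P] {a : ℝ} (ha : 0 < a) {S : Ω → ℝ}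
    (h : HasExpMoment P a S) {lam : ℝ} (hlam : |lam| ≤ a / 2) :
    mgf S P lam ≤ Real.exp (lam * ∫ ω, S ω ∂P + 24 * lam ^ 2 / a ^ 2) := by
  -- Half of the exponent `a |S|` controls `exp |lam S|`; the other half absorbs `S²` through `x² /
  -- 2 ≤ exp x` with `x = a |S| / 2`. The moment bound `3` then turns `8` into `24`.
  have hpt : ∀ ω, Real.exp (lam * S ω) ≤
      1 + lam * S ω + 8 * lam ^ 2 / a ^ 2 * Real.exp (a * |S ω|) := by
    intro ω
    refine (exp_le_one_add_add _).trans ?_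
    have h1 : Real.exp |lam * S ω| ≤ Real.exp (a * |S ω| / 2) := by
      rw [Real.exp_le_exp, abs_mul]
      have := mul_le_mul_of_nonneg_right hlam (abs_nonneg (S ω))
      linarith
    have h2 : S ω ^ 2 ≤ 8 / a ^ 2 * Real.exp (a * |S ω| / 2) := by
      have hx : 0 ≤ a * |S ω| / 2 := by positivity
      have := Real.quadratic_le_exp_of_nonneg hx
      rw [div_mul_eq_mul_div, le_div_iff₀ (by positivity), ← sq_abs (S ω)]
      nlinarith
    have h3 : Real.exp (a * |S ω|) = Real.exp (a * |S ω| / 2) * Real.exp (a * |S ω| / 2) := by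
      rw [← Real.exp_add]; congr 1; ring
    have h4 : (lam * S ω) ^ 2 * Real.exp |lam * S ω| ≤
        (lam ^ 2 * (8 / a ^ 2 * Real.exp (a * |S ω| / 2))) * Real.exp (a * |S ω| / 2) := by
      rw [mul_pow]
      gcongr
    rw [h3]
    have h5 : (lam ^ 2 * (8 / a ^ 2 * Real.exp (a * |S ω| / 2))) * Real.exp (a * |S ω| / 2) =
      8 * lam ^ 2 / a ^ 2 * (Real.exp (a * |S ω| / 2) * Real.exp (a * |S ω| / 2)) := by ring
    linarith
  have hS := h.integrable_self ha
  have h1 : Integrable (fun ω => 1 + lam * S ω) P := (integrable_const 1).add (hS.const_mul lam)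
  have h2 := h.integrable.const_mul (8 * lam ^ 2 / a ^ 2)
  have hle := integral_mono (h.integrable_exp_mul (by linarith : |lam| ≤ a)) (h1.add h2) hpt
  simp only [Pi.add_apply] at hle
  rw [integral_add h1 h2, integral_add (integrable_const 1) (hS.const_mul lam),
    integral_const_mul, integral_const_mul] at hle
  simp only [integral_const, probReal_univ, smul_eq_mul, mul_one] at hle
  have h3 : 8 * lam ^ 2 / a ^ 2 * ∫ ω, Real.exp (a * |S ω|) ∂P ≤ 8 * lam ^ 2 / a ^ 2 * 3 :=
    mul_le_mul_of_nonneg_left h.le_three (by positivity)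
  have h4 := Real.add_one_le_exp (lam * ∫ ω, S ω ∂P + 24 * lam ^ 2 / a ^ 2)
  have h5 : 8 * lam ^ 2 / a ^ 2 * 3 = 24 * lam ^ 2 / a ^ 2 := by ring
  unfold mgf
  linarith

theorem measureReal_mean_ge_le [IsProbabilityMeasure P] {n : ℕ} {a m : ℝ} (ha : 0 < a)
    {S : Fin n → Ω → ℝ} (hind : iIndepFun S P) (h : ∀ i, HasExpMoment P a (S i))
    (hm : ∀ i, ∫ ω, S i ω ∂P = m) {t : ℝ} (ht : 0 ≤ t) (hta : t ≤ 24 / a) :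
    P.real {ω | n * (m + t) ≤ ∑ i, S i ω} ≤ Real.exp (-(n * a ^ 2 * t ^ 2 / 96)) := by
  -- The minimizer of `-lam * t + 24 * lam² / a²`, with value `-a² t² / 96`; the restriction on `t`
  -- says exactly that `lam ≤ a / 2`.
  set lam := a ^ 2 * t / 48 with hlamdef
  have hlam0 : 0 ≤ lam := by positivity
  have hlam : |lam| ≤ a / 2 := by
    rw [abs_of_nonneg hlam0, hlamdef]
    rw [le_div_iff₀ ha] at hta
    nlinarith
  -- If integrability failed, the moment generating function would take the default value zero, yet
  -- it is a product of positive factors.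
  have hint : Integrable (fun ω => Real.exp (lam * (∑ i, S i) ω)) P := by
    by_contra hni
    have h0 : mgf (∑ i, S i) P lam = 0 := integral_undef hni
    rw [hind.mgf_sum₀ fun i => (h i).aemeasurable] at h0
    exact (Finset.prod_pos fun i _ =>
      mgf_pos ((h i).integrable_exp_mul (by linarith : |lam| ≤ a))).ne' h0
  have h1 := measure_ge_le_exp_mul_mgf (n * (m + t)) hlam0 hint
  rw [hind.mgf_sum₀ fun i => (h i).aemeasurable] at h1
  have h2 : ∏ i, mgf (S i) P lam ≤ ∏ _i : Fin n, Real.exp (lam * m + 24 * lam ^ 2 / a ^ 2) :=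
    Finset.prod_le_prod (fun i _ => mgf_nonneg) fun i _ => by
      rw [← hm i]; exact (h i).mgf_le ha hlam
  rw [Finset.prod_const, Finset.card_univ, Fintype.card_fin, ← Real.exp_nat_mul] at h2
  have h3 := h1.trans (mul_le_mul_of_nonneg_left h2 (Real.exp_nonneg _))
  rw [← Real.exp_add] at h3
  simp only [Finset.sum_apply] at h3
  refine h3.trans_eq ?_
  congr 1
  rw [hlamdef]
  field_simp
  ring

theorem measureReal_abs_mean_sub_ge_le [IsProbabilityMeasure P] {n : ℕ} (hn : 0 < n) {a m : ℝ}
    (ha : 0 < a) {S : Fin n → Ω → ℝ} (hind : iIndepFun S P) (h : ∀ i, HasExpMoment P a (S i))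
    (hm : ∀ i, ∫ ω, S i ω ∂P = m) {t : ℝ} (ht : 0 ≤ t) (hta : t ≤ 24 / a) :
    P.real {ω | t ≤ |(n : ℝ)⁻¹ * ∑ i, S i ω - m|} ≤
      2 * Real.exp (-(n * a ^ 2 * t ^ 2 / 96)) := by
  have hn' : (0 : ℝ) < n := by exact_mod_cast hn
  have hneg : iIndepFun (fun i ω => -S i ω) P :=
    hind.comp (fun _ x => -x) fun _ => measurable_neg
  have h1 := measureReal_mean_ge_le ha hind h hm ht hta
  have h2 := measureReal_mean_ge_le ha hneg (fun i => (h i).neg) (m := -m)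
    (fun i => by rw [integral_neg, hm]) ht hta
  have hsub : {ω | t ≤ |(n : ℝ)⁻¹ * ∑ i, S i ω - m|} ⊆
      {ω | n * (m + t) ≤ ∑ i, S i ω} ∪ {ω | n * (-m + t) ≤ ∑ i, -S i ω} := by
    intro ω hω
    rw [Set.mem_ofPred_eq] at hω
    have hmul : (n : ℝ) * ((n : ℝ)⁻¹ * ∑ i, S i ω) = ∑ i, S i ω := by field_simp
    rcases le_abs.1 hω with h | h
    · left
      rw [Set.mem_ofPred_eq, ← hmul]
      exact mul_le_mul_of_nonneg_left (by linarith) hn'.le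
    · right
      rw [Set.mem_ofPred_eq, Finset.sum_neg_distrib, ← hmul, ← mul_neg]
      exact mul_le_mul_of_nonneg_left (by linarith) hn'.le
  have h3 := (measureReal_mono (μ := P) hsub).trans (measureReal_union_le _ _)
  linarith

theorem measureReal_exists_abs_mean_sub_ge_le [IsProbabilityMeasure P] {n : ℕ} (hn : 0 < n)
    {E ι : Type*} [MeasurableSpace E] [Fintype ι] {Z : Ω → E} {Zs : Fin n → Ω → E}
    (hind : iIndepFun Zs P) (hid : ∀ i, IdentDistrib (Zs i) Z P P) {a : ℝ} (ha : 0 < a)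
    {g : ι → E → ℝ} (hg : ∀ l, Measurable (g l)) (h : ∀ l, HasExpMoment P a fun ω => g l (Z ω))
    {t : ℝ} (ht : 0 ≤ t) (hta : t ≤ 24 / a) :
    P.real {ω | ∃ l, t ≤ |(n : ℝ)⁻¹ * ∑ i, g l (Zs i ω) - ∫ ω, g l (Z ω) ∂P|} ≤
      Fintype.card ι * (2 * Real.exp (-(n * a ^ 2 * t ^ 2 / 96))) := by
  have hident : ∀ l i, IdentDistrib (fun ω => g l (Zs i ω)) (fun ω => g l (Z ω)) P P :=
    fun l i => (hid i).comp (hg l)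
  have hexp : ∀ l i, HasExpMoment P a fun ω => g l (Zs i ω) := fun l i => by
    have hme : Measurable fun x : ℝ => Real.exp (a * |x|) := by fun_prop
    have h1 := (hident l i).comp hme
    exact ⟨(hident l i).aemeasurable_fst, h1.integrable_iff.2 (h l).integrable,
      h1.integral_eq.trans_le (h l).le_three⟩
  have hset : {ω | ∃ l, t ≤ |(n : ℝ)⁻¹ * ∑ i, g l (Zs i ω) - ∫ ω, g l (Z ω) ∂P|} =
      ⋃ l, {ω | t ≤ |(n : ℝ)⁻¹ * ∑ i, g l (Zs i ω) - ∫ ω, g l (Z ω) ∂P|} := by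
    ext ω; simp
  rw [hset]
  refine (measureReal_iUnion_fintype_le _).trans ?_
  refine (Finset.sum_le_sum fun l _ => measureReal_abs_mean_sub_ge_le hn ha
    (hind.comp (fun _ => g l) fun _ => hg l) (hexp l)
    (fun i => (hident l i).integral_eq) ht hta).trans_eq ?_
  simp

end Concentration

/-! ### Population covariances -/

section Covariance

variable {Ω : Type*} [MeasurableSpace Ω] {P : Measure Ω}

theorem covMatrix_transpose {a b : ℕ} (X : Ω → Fin a → ℝ) (Y : Ω → Fin b → ℝ) :
    (covMatrix P X Y)ᵀ = covMatrix P Y X := by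
  ext i j
  simp [covMatrix, covariance_comm]

variable [IsProbabilityMeasure P]

theorem dotProduct_covMatrix_mulVec {a b : ℕ} {X : Ω → Fin a → ℝ} {Y : Ω → Fin b → ℝ}
    (hX : ∀ i, MemLp (fun ω => X ω i) 2 P) (hY : ∀ j, MemLp (fun ω => Y ω j) 2 P)
    (x : Fin a → ℝ) (y : Fin b → ℝ) :
    x ⬝ᵥ (covMatrix P X Y *ᵥ y) = cov[fun ω => x ⬝ᵥ X ω, fun ω => y ⬝ᵥ Y ω; P] := by
  have h := covariance_fun_sum_fun_sum (μ := P) (X := fun i ω => x i * X ω i)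
    (Y := fun j ω => y j * Y ω j) (fun i => (hX i).const_mul _) (fun j => (hY j).const_mul _)
  refine Eq.trans ?_ h.symm
  simp only [dotProduct, mulVec, Finset.mul_sum, covariance_const_mul_left,
    covariance_const_mul_right, covMatrix, Matrix.of_apply]
  exact Finset.sum_congr rfl fun i _ => Finset.sum_congr rfl fun j _ => by ring

theorem two_mul_abs_covariance_le {A B : Ω → ℝ} (hA : MemLp A 2 P) (hB : MemLp B 2 P) :
    2 * |cov[A, B; P]| ≤ ∫ ω, A ω ^ 2 ∂P + ∫ ω, B ω ^ 2 ∂P := by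
  have h1 := variance_add hA hB
  have h2 := variance_sub hA hB
  have h3 := variance_nonneg (A + B) P
  have h4 := variance_nonneg (A - B) P
  have h5 : Var[A; P] ≤ ∫ ω, A ω ^ 2 ∂P := variance_le_expectation_sq hA.1
  have h6 : Var[B; P] ≤ ∫ ω, B ω ^ 2 ∂P := variance_le_expectation_sq hB.1
  rcases abs_cases (cov[A, B; P]) with ⟨h, -⟩ | ⟨h, -⟩ <;> rw [h] <;> linarith

/-- With `G = Σ y`, test the covariance against `L⁻¹ G`. This scaling makes the bound on the second
moment of `L⁻¹ G ⬝ᵥ X` equal to half of the left side, where it is absorbed. -/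
theorem covMatrix_mulVec_sq_le {a b : ℕ} {X : Ω → Fin a → ℝ} {Y : Ω → Fin b → ℝ}
    (hX : ∀ i, MemLp (fun ω => X ω i) 2 P) (hY : ∀ j, MemLp (fun ω => Y ω j) 2 P) {L : ℝ}
    (hL : 0 < L) (hX2 : ∀ x : Fin a → ℝ, ∫ ω, (x ⬝ᵥ X ω) ^ 2 ∂P ≤ L * (x ⬝ᵥ x))
    (hY2 : ∀ y : Fin b → ℝ, ∫ ω, (y ⬝ᵥ Y ω) ^ 2 ∂P ≤ L * (y ⬝ᵥ y)) (y : Fin b → ℝ) :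
    (covMatrix P X Y *ᵥ y) ⬝ᵥ (covMatrix P X Y *ᵥ y) ≤ L ^ 2 * (y ⬝ᵥ y) := by
  have hlin : ∀ {m : ℕ} {Z : Ω → Fin m → ℝ} (_ : ∀ i, MemLp (fun ω => Z ω i) 2 P)
      (z : Fin m → ℝ), MemLp (fun ω => z ⬝ᵥ Z ω) 2 P := fun hZ z =>
    memLp_finsetSum _ fun i _ => (hZ i).const_mul (z i)
  set G := covMatrix P X Y *ᵥ y with hG
  have h := two_mul_abs_covariance_le (hlin hX (L⁻¹ • G)) (hlin hY y)
  rw [← dotProduct_covMatrix_mulVec hX hY, ← hG] at h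
  have h1 := hX2 (L⁻¹ • G)
  have h2 := hY2 y
  rw [smul_dotProduct, smul_eq_mul] at h
  simp only [dotProduct_smul (L⁻¹) (L⁻¹ • G) G, smul_dotProduct (L⁻¹) G G, smul_eq_mul] at h1
  have h3 := le_abs_self (L⁻¹ * (G ⬝ᵥ G))
  have h4 : L * (L⁻¹ * (L⁻¹ * (G ⬝ᵥ G))) = L⁻¹ * (G ⬝ᵥ G) := mul_inv_cancel_left₀ hL.ne' _
  have h5 : L⁻¹ * (G ⬝ᵥ G) ≤ L * (y ⬝ᵥ y) := by linarith
  rw [inv_mul_le_iff₀ hL] at h5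
  linarith

theorem covMatrix_self_quadratic_nonneg {a : ℕ} {X : Ω → Fin a → ℝ}
    (hX : ∀ i, MemLp (fun ω => X ω i) 2 P) (x : Fin a → ℝ) :
    0 ≤ x ⬝ᵥ (covMatrix P X X *ᵥ x) := by
  rw [dotProduct_covMatrix_mulVec hX hX, covariance_self]
  · exact variance_nonneg _ _
  · have : MemLp (fun ω => x ⬝ᵥ X ω) 2 P := memLp_finsetSum _ fun i _ => (hX i).const_mul (x i)
    exact this.1.aemeasurable

end Covariance

/-! ### Moments under the joint sub-Gaussian condition -/

section SubGaussian

variable {Ω : Type*} [MeasurableSpace Ω] {P : Measure Ω} {p r : ℕ}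
  {X : Ω → Fin p → ℝ} {Y : Ω → Fin r → ℝ} {σ : ℝ}

theorem HasExpMoment.integral_sq_le {a : ℝ} (ha : 0 < a) {W : Ω → ℝ}
    (h : HasExpMoment P a fun ω => W ω ^ 2) : ∫ ω, W ω ^ 2 ∂P ≤ 3 / a := by
  have := h.integral_abs_le ha
  simpa using this

theorem HasExpMoment.memLp_two {a : ℝ} (ha : 0 < a) {W : Ω → ℝ} (hW : AEMeasurable W P)
    (h : HasExpMoment P a fun ω => W ω ^ 2) : MemLp W 2 P :=
  (memLp_two_iff_integrable_sq hW.aestronglyMeasurable).2 (h.integrable_self ha)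

theorem aemeasurable_dotProduct {m : ℕ} {Z : Ω → Fin m → ℝ} (hZ : AEMeasurable Z P)
    (z : Fin m → ℝ) : AEMeasurable (fun ω => z ⬝ᵥ Z ω) P := by
  have h : Measurable fun x : Fin m → ℝ => z ⬝ᵥ x := by
    unfold dotProduct
    fun_prop
  exact h.comp_aemeasurable hZ

theorem IsJointSubGaussian.mono {σ' : ℝ} (h : IsJointSubGaussian P σ X Y) (hσ : 0 < σ)
    (hσ' : σ ≤ σ') : IsJointSubGaussian P σ' X Y := by
  intro w z hwz t ht
  refine (h w z hwz t ht).trans ?_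
  gcongr

/-- The coordinates of a pair of vectors, together with the constant `1`. -/
def pairCoord {p r : ℕ} : Option (Fin p ⊕ Fin r) → (Fin p → ℝ) × (Fin r → ℝ) → ℝ
  | none, _ => 1
  | some (Sum.inl i), z => z.1 i
  | some (Sum.inr j), z => z.2 j

theorem measurable_pairCoord (c : Option (Fin p ⊕ Fin r)) :
    Measurable (pairCoord (p := p) (r := r) c) := by
  rcases c with _ | i | j
  · exact measurable_const
  · exact (measurable_pi_apply i).comp measurable_fst
  · exact (measurable_pi_apply j).comp measurable_snd

theorem aemeasurable_pairCoord (hX : AEMeasurable X P) (hY : AEMeasurable Y P)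
    (c : Option (Fin p ⊕ Fin r)) : AEMeasurable (fun ω => pairCoord c (X ω, Y ω)) P :=
  (measurable_pairCoord c).comp_aemeasurable (hX.prodMk hY)

variable [IsProbabilityMeasure P]

theorem IsJointSubGaussian.hasExpMoment (h : IsJointSubGaussian P σ X Y) (hσ : 0 < σ)
    (hX : AEMeasurable X P) (hY : AEMeasurable Y P) {w : Fin p → ℝ} {z : Fin r → ℝ}
    (hwz : w ⬝ᵥ w + z ⬝ᵥ z = 1) :
    HasExpMoment P (1 / (2 * σ ^ 2)) fun ω => (w ⬝ᵥ X ω + z ⬝ᵥ Y ω) ^ 2 :=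
  HasExpMoment.sq_of_tail hσ ((aemeasurable_dotProduct hX w).add (aemeasurable_dotProduct hY z))
    (h w z hwz)

theorem IsJointSubGaussian.integral_sq_le (h : IsJointSubGaussian P σ X Y) (hσ : 0 < σ)
    (hX : AEMeasurable X P) (hY : AEMeasurable Y P) (w : Fin p → ℝ) (z : Fin r → ℝ) :
    ∫ ω, (w ⬝ᵥ X ω + z ⬝ᵥ Y ω) ^ 2 ∂P ≤ 3 / (1 / (2 * σ ^ 2)) * (w ⬝ᵥ w + z ⬝ᵥ z) := by
  have ha : 0 < 1 / (2 * σ ^ 2) := by positivity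
  have hw0 := dotProduct_self_nonneg w
  have hz0 := dotProduct_self_nonneg z
  rcases (add_nonneg hw0 hz0).eq_or_lt with h0 | h0
  · have h1 : w = 0 := dotProduct_self_eq_zero.1 (by linarith)
    have h2 : z = 0 := dotProduct_self_eq_zero.1 (by linarith)
    simp [h1, h2]
  · obtain ⟨q, hq, hqq⟩ : ∃ q : ℝ, 0 < q ∧ q * q = w ⬝ᵥ w + z ⬝ᵥ z :=
      ⟨√(w ⬝ᵥ w + z ⬝ᵥ z), Real.sqrt_pos.2 h0, Real.mul_self_sqrt h0.le⟩
    have hunit : (q⁻¹ • w) ⬝ᵥ (q⁻¹ • w) + (q⁻¹ • z) ⬝ᵥ (q⁻¹ • z) = 1 := by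
      simp only [smul_dotProduct, dotProduct_smul, smul_eq_mul]
      rw [← mul_add, ← mul_add, ← hqq]
      field_simp
    have h1 := (h.hasExpMoment hσ hX hY hunit).integral_sq_le ha
    have h2 : ∀ ω, (w ⬝ᵥ X ω + z ⬝ᵥ Y ω) ^ 2 =
        (q * q) * ((q⁻¹ • w) ⬝ᵥ X ω + (q⁻¹ • z) ⬝ᵥ Y ω) ^ 2 := fun ω => by
      simp only [smul_dotProduct, smul_eq_mul]
      field_simp
    simp_rw [h2]
    rw [integral_const_mul, ← hqq, mul_comm (3 / _)]
    exact mul_le_mul_of_nonneg_left h1 (by positivity)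

theorem IsJointSubGaussian.hasExpMoment_pairCoord_sq (h : IsJointSubGaussian P σ X Y)
    (hσ : 1 ≤ σ) (hX : AEMeasurable X P) (hY : AEMeasurable Y P)
    (c : Option (Fin p ⊕ Fin r)) :
    HasExpMoment P (1 / (2 * σ ^ 2)) fun ω => pairCoord c (X ω, Y ω) ^ 2 := by
  have hσ0 : 0 < σ := by linarith
  rcases c with _ | i | j
  · have : 1 / (2 * σ ^ 2) ≤ 1 := by
      rw [div_le_one (by positivity)]
      nlinarith
    simpa [pairCoord] using HasExpMoment.const_one (P := P) this
  · simpa [pairCoord] using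
      h.hasExpMoment hσ0 hX hY (w := Pi.single i 1) (z := 0) (by simp)
  · simpa [pairCoord] using
      h.hasExpMoment hσ0 hX hY (w := 0) (z := Pi.single j 1) (by simp)

theorem IsJointSubGaussian.hasExpMoment_mul (h : IsJointSubGaussian P σ X Y)
    (hσ : 1 ≤ σ) (hX : AEMeasurable X P) (hY : AEMeasurable Y P)
    (c c' : Option (Fin p ⊕ Fin r)) :
    HasExpMoment P (1 / (2 * σ ^ 2)) fun ω => pairCoord c (X ω, Y ω) * pairCoord c' (X ω, Y ω) :=
  HasExpMoment.mul (by positivity) (aemeasurable_pairCoord hX hY c)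
    (aemeasurable_pairCoord hX hY c') (h.hasExpMoment_pairCoord_sq hσ hX hY c)
    (h.hasExpMoment_pairCoord_sq hσ hX hY c')

theorem IsJointSubGaussian.memLp_pairCoord (h : IsJointSubGaussian P σ X Y)
    (hσ : 1 ≤ σ) (hX : AEMeasurable X P) (hY : AEMeasurable Y P)
    (c : Option (Fin p ⊕ Fin r)) : MemLp (fun ω => pairCoord c (X ω, Y ω)) 2 P :=
  (h.hasExpMoment_pairCoord_sq hσ hX hY c).memLp_two
    (by have : 0 < σ := by linarith
        positivity) (aemeasurable_pairCoord hX hY c)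

theorem IsJointSubGaussian.abs_integral_pairCoord_le (h : IsJointSubGaussian P σ X Y)
    (hσ : 1 ≤ σ) (hX : AEMeasurable X P) (hY : AEMeasurable Y P)
    (c : Option (Fin p ⊕ Fin r)) : |∫ ω, pairCoord c (X ω, Y ω) ∂P| ≤ 3 / (1 / (2 * σ ^ 2)) := by
  have h1 := (h.hasExpMoment_mul hσ hX hY c none).integral_abs_le
    (by have : 0 < σ := by linarith
        positivity)
  simp only [show ∀ ω, pairCoord (none : Option (Fin p ⊕ Fin r)) (X ω, Y ω) = 1 from fun _ => rfl,
    mul_one] at h1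
  exact (abs_integral_le_integral_abs).trans h1

end SubGaussian

/-! ### Sample covariances -/

section Sample

theorem inv_mul_sum_centred_mul {n : ℕ} (hn : 0 < n) (a b : Fin n → ℝ) :
    (n : ℝ)⁻¹ * ∑ i, (a i - (n : ℝ)⁻¹ * ∑ i', a i') * (b i - (n : ℝ)⁻¹ * ∑ i', b i') =
      (n : ℝ)⁻¹ * ∑ i, a i * b i - ((n : ℝ)⁻¹ * ∑ i, a i) * ((n : ℝ)⁻¹ * ∑ i, b i) := by
  have hn' : (n : ℝ) ≠ 0 := by exact_mod_cast hn.ne'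
  simp only [sub_mul, mul_sub, Finset.sum_sub_distrib, ← Finset.mul_sum, ← Finset.sum_mul,
    Finset.sum_const, Finset.card_univ, Fintype.card_fin, nsmul_eq_mul]
  field_simp
  ring

theorem abs_mul_sub_mul_le {x y m m' t L : ℝ} (hx : |x - m| ≤ t) (hy : |y - m'| ≤ t)
    (ht : t ≤ 1) (hm : |m| ≤ L) (hm' : |m'| ≤ L) :
    |x * y - m * m'| ≤ (1 + 2 * L) * t := by
  have ht0 : 0 ≤ t := (abs_nonneg _).trans hx
  have h1 : x * y - m * m' = (x - m) * (y - m') + (x - m) * m' + m * (y - m') := by ring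
  rw [h1]
  refine (abs_add_three _ _ _).trans ?_
  rw [abs_mul, abs_mul, abs_mul]
  have e1 := mul_le_mul hx (hy.trans ht) (abs_nonneg _) ht0
  have e2 := mul_le_mul hx hm' (abs_nonneg _) ht0
  have e3 := mul_le_mul hm hy (abs_nonneg _) ((abs_nonneg _).trans hm)
  linarith

variable {Ω : Type*} [MeasurableSpace Ω] {P : Measure Ω} [IsProbabilityMeasure P] {n p r : ℕ}
  {X : Ω → Fin p → ℝ} {Y : Ω → Fin r → ℝ} {σ : ℝ}

/-- Pairing a coordinate with the constant coordinate controls its sample mean, so the hypothesis on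
products also handles the centring; `t ≤ 1` makes the product of mean errors linear in `t`. -/
theorem IsJointSubGaussian.abs_sample_sub_cov_le (h : IsJointSubGaussian P σ X Y)
    (hσ : 1 ≤ σ) (hX : AEMeasurable X P) (hY : AEMeasurable Y P) (hn : 0 < n)
    {z : Fin n → (Fin p → ℝ) × (Fin r → ℝ)} {t : ℝ} (ht : t ≤ 1)
    (hz : ∀ c c' : Option (Fin p ⊕ Fin r),
      |(n : ℝ)⁻¹ * ∑ i, pairCoord c (z i) * pairCoord c' (z i) -
      ∫ ω, pairCoord c (X ω, Y ω) * pairCoord c' (X ω, Y ω) ∂P| ≤ t)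
    (c c' : Option (Fin p ⊕ Fin r)) :
    |(n : ℝ)⁻¹ * ∑ i, (pairCoord c (z i) - (n : ℝ)⁻¹ * ∑ i', pairCoord c (z i')) *
        (pairCoord c' (z i) - (n : ℝ)⁻¹ * ∑ i', pairCoord c' (z i')) -
      cov[fun ω => pairCoord c (X ω, Y ω), fun ω => pairCoord c' (X ω, Y ω); P]| ≤
        (2 + 2 * (3 / (1 / (2 * σ ^ 2)))) * t := by
  have hmean : ∀ c : Option (Fin p ⊕ Fin r), |(n : ℝ)⁻¹ * ∑ i, pairCoord c (z i) -
      ∫ ω, pairCoord c (X ω, Y ω) ∂P| ≤ t := fun c => by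
    simpa [pairCoord] using hz c none
  have h1 := abs_mul_sub_mul_le (hmean c) (hmean c') ht (h.abs_integral_pairCoord_le hσ hX hY c)
    (h.abs_integral_pairCoord_le hσ hX hY c')
  have h2 := hz c c'
  rw [inv_mul_sum_centred_mul hn, covariance_eq_sub (h.memLp_pairCoord hσ hX hY c)
    (h.memLp_pairCoord hσ hX hY c')]
  simp only [Pi.mul_apply]
  rw [sub_sub_sub_comm]
  refine (abs_sub _ _).trans ?_
  linarith

theorem IsJointSubGaussian.abs_raw_sub_cov_le (h : IsJointSubGaussian P σ X Y)
    (hσ : 1 ≤ σ) (hX : AEMeasurable X P) (hY : AEMeasurable Y P)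
    {z : Fin n → (Fin p → ℝ) × (Fin r → ℝ)} {t : ℝ} (ht0 : 0 ≤ t)
    (hz : ∀ c c' : Option (Fin p ⊕ Fin r),
      |(n : ℝ)⁻¹ * ∑ i, pairCoord c (z i) * pairCoord c' (z i) -
      ∫ ω, pairCoord c (X ω, Y ω) * pairCoord c' (X ω, Y ω) ∂P| ≤ t)
    (c c' : Option (Fin p ⊕ Fin r)) (hc : ∫ ω, pairCoord c (X ω, Y ω) ∂P = 0) :
    |(n : ℝ)⁻¹ * ∑ i, pairCoord c (z i) * pairCoord c' (z i) -
      cov[fun ω => pairCoord c (X ω, Y ω), fun ω => pairCoord c' (X ω, Y ω); P]| ≤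
        (2 + 2 * (3 / (1 / (2 * σ ^ 2)))) * t := by
  rw [covariance_eq_sub (h.memLp_pairCoord hσ hX hY c) (h.memLp_pairCoord hσ hX hY c'), hc,
    zero_mul, sub_zero]
  refine (hz c c').trans ?_
  have : 0 ≤ 3 / (1 / (2 * σ ^ 2)) := by positivity
  nlinarith

end Sample

/-! ### Consistency -/

section Consistency

theorem card_pairCoord_le {p r : ℕ} (hp : 1 ≤ p) (hr : 1 ≤ r) :
    (Fintype.card (Option (Fin p ⊕ Fin r) × Option (Fin p ⊕ Fin r)) : ℝ) ≤
      9 * Real.exp (2 * (Real.log p + Real.log r)) := by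
  have hp' : (1 : ℝ) ≤ p := by exact_mod_cast hp
  have hr' : (1 : ℝ) ≤ r := by exact_mod_cast hr
  have h1 : Real.exp (2 * (Real.log p + Real.log r)) = (p * r : ℝ) ^ 2 := by
    rw [← Real.log_mul (by positivity) (by positivity), two_mul, Real.exp_add,
      Real.exp_log (by positivity), sq]
  have h2 : (p + r + 1 : ℝ) ≤ 3 * (p * r) := by nlinarith
  rw [h1, Fintype.card_prod, Fintype.card_option, Fintype.card_sum, Fintype.card_fin,
    Fintype.card_fin]
  push_cast
  nlinarith

/-- Centred and raw estimators differ only in how moment errors pass to covariance errors; `herr`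
isolates that step. -/
theorem subspaceConsistent_of_sample_error
    {n p r : ℕ → ℕ} (hn : Tendsto n atTop atTop) (hp : Tendsto p atTop atTop)
    (hr : Tendsto r atTop atTop) {Ω : ℕ → Type*} [∀ k, MeasurableSpace (Ω k)]
    {P : ∀ k, Measure (Ω k)} [∀ k, IsProbabilityMeasure (P k)]
    {X : ∀ k, Ω k → Fin (p k) → ℝ} {Y : ∀ k, Ω k → Fin (r k) → ℝ}
    (hX : ∀ k, AEMeasurable (X k) (P k)) (hY : ∀ k, AEMeasurable (Y k) (P k))
    {σ : ℝ} (hσ : 1 ≤ σ) (hsubG : ∀ k, IsJointSubGaussian (P k) σ (X k) (Y k))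
    {Xs : ∀ k, Fin (n k) → Ω k → Fin (p k) → ℝ} {Ys : ∀ k, Fin (n k) → Ω k → Fin (r k) → ℝ}
    (hsample : ∀ k, IsIIDSample (P k) (X k) (Y k) (Xs k) (Ys k))
    {d : ℕ} {V : ∀ k, Fin d → Fin (r k) → ℝ}
    (hV : ∀ k, IsLeadingEigenvectors (covMatrix_isHermitian (P k) (Y k)) (V k))
    {Δ : ℝ} (hΔ : 0 < Δ)
    (hgap : ∀ k, ∀ j < d,
      Δ ≤ sortedEigenvalue (covMatrix_isHermitian (P k) (Y k)) j -
        sortedEigenvalue (covMatrix_isHermitian (P k) (Y k)) (j + 1))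
    (henv : ∀ k, responseEnvelope (P k) (X k) (Y k) ≤ Submodule.span ℝ (Set.range (V k)))
    {u : ℕ → ℕ} (hu : ∀ k, 1 ≤ u k)
    (hdim : ∀ k, Module.finrank ℝ (responseEnvelope (P k) (X k) (Y k)) = u k)
    {τ : ℕ → ℝ} (hτ : ∀ k j, l1Norm (V k j) ≤ τ k)
    (hlog : (fun k => √(Real.log (p k) + Real.log (r k))) =o[atTop] fun k => √(n k : ℝ))
    (hpn : ∀ᶠ k in atTop, √(Real.log (p k) + Real.log (r k)) < √(n k : ℝ) / (p k : ℝ))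
    (hrate : (fun k => max (τ k ^ 2 * √(Real.log (p k) + Real.log (r k)))
        ((scoreGap (popU (P k) (X k) (Y k)) (V k) (u k) ^ 2)⁻¹ * τ k ^ 2 *
          √(Real.log (p k) + Real.log (r k)))) =o[atTop] fun k => √(n k : ℝ))
    {A : ∀ k, Ω k → Matrix (Fin (n k)) (Fin (p k)) ℝ}
    {B : ∀ k, Ω k → Matrix (Fin (n k)) (Fin (r k)) ℝ} {C₁ : ℝ} (hC₁ : 0 ≤ C₁)
    (herr : ∀ k, 0 < n k → ∀ ω t, 0 ≤ t → t ≤ 1 →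
      (∀ c c' : Option (Fin (p k) ⊕ Fin (r k)),
        |(n k : ℝ)⁻¹ * ∑ i, pairCoord c (Xs k i ω, Ys k i ω) * pairCoord c' (Xs k i ω, Ys k i ω) -
          ∫ ω, pairCoord c (X k ω, Y k ω) * pairCoord c' (X k ω, Y k ω) ∂(P k)| ≤ t) →
      (∀ i j, |sampleCrossCov (B k ω) (B k ω) i j - covMatrix (P k) (Y k) (Y k) i j| ≤ C₁ * t) ∧
      ∀ i j, |sampleCrossCov (A k ω) (B k ω) i j - covMatrix (P k) (X k) (Y k) i j| ≤ C₁ * t)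
    {Ehat : ∀ k, Ω k → Submodule ℝ (Fin (r k) → ℝ)}
    (hEhat : ∀ k ω, IsSparseNIECE (A k ω) (B k ω) (τ k) d (u k) (Ehat k ω)) :
    SubspaceConsistent P (fun k => responseEnvelope (P k) (X k) (Y k)) Ehat := by
  have hσ0 : 0 < σ := by linarith
  set a := 1 / (2 * σ ^ 2) with ha
  have ha0 : 0 < a := by positivity
  set L := 3 / a with hL
  have hL0 : 0 < L := by positivity
  -- Since `288 = 3 * 96`, the deviation `K * q k` has Bernstein exponent `3 * ell k`. The union
  -- bound has at most `9 exp (2 * ell k)` terms, which leaves `18 exp (-ell k)`.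
  set K := √288 / a with hK
  have hK0 : 0 < K := by positivity
  have hKsq : K ^ 2 * a ^ 2 = 288 := by
    rw [hK, div_pow, Real.sq_sqrt (by norm_num)]
    field_simp
  obtain ⟨C, hC, hbound⟩ := exists_sparseNIECE_bound d hL0.le hΔ (κ := C₁ * K) (by positivity)
  have hpopU : ∀ k, popU (P k) (X k) (Y k) =
      (covMatrix (P k) (X k) (Y k))ᵀ * covMatrix (P k) (X k) (Y k) := fun k => by
    rw [covMatrix_transpose, popU]
  have hE : ∀ k, responseEnvelope (P k) (X k) (Y k) = envelope (covMatrix (P k) (Y k) (Y k))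
      ((covMatrix (P k) (X k) (Y k))ᵀ * covMatrix (P k) (X k) (Y k)) := fun k => by
    rw [responseEnvelope, hpopU]
  have hgpos : ∀ k, 0 < scoreGap (popU (P k) (X k) (Y k)) (V k) (u k) := fun k => by
    rw [hpopU]
    exact scoreGap_pos _ (hV k) hΔ (hgap k) (hE k ▸ henv k) (hu k) (hE k ▸ hdim k)
  set ell : ℕ → ℝ := fun k => Real.log (p k) + Real.log (r k) with hell
  set q : ℕ → ℝ := fun k => √(ell k) / √(n k : ℝ) with hq
  have hq0 : ∀ k, 0 ≤ q k := fun k => by positivity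
  set m : ℕ → ℝ := fun k => max (τ k ^ 2 * √(ell k))
    ((scoreGap (popU (P k) (X k) (Y k)) (V k) (u k) ^ 2)⁻¹ * τ k ^ 2 * √(ell k)) /
      √(n k : ℝ) with hm
  have hqlim : Tendsto q atTop (𝓝 0) := hlog.tendsto_div_nhds_zero
  have hmlim : Tendsto m atTop (𝓝 0) := hrate.tendsto_div_nhds_zero
  have hX2 : ∀ k i, MemLp (fun ω => X k ω i) 2 (P k) := fun k i =>
    (hsubG k).memLp_pairCoord hσ (hX k) (hY k) (some (Sum.inl i))
  have hY2 : ∀ k i, MemLp (fun ω => Y k ω i) 2 (P k) := fun k i =>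
    (hsubG k).memLp_pairCoord hσ (hX k) (hY k) (some (Sum.inr i))
  have hXL : ∀ k (x : Fin (p k) → ℝ), ∫ ω, (x ⬝ᵥ X k ω) ^ 2 ∂(P k) ≤ L * (x ⬝ᵥ x) := fun k x => by
    have h := (hsubG k).integral_sq_le hσ0 (hX k) (hY k) x 0
    simpa only [zero_dotProduct, dotProduct_zero, add_zero, zero_add] using h
  have hYL : ∀ k (x : Fin (r k) → ℝ), ∫ ω, (x ⬝ᵥ Y k ω) ^ 2 ∂(P k) ≤ L * (x ⬝ᵥ x) := fun k x => by
    have h := (hsubG k).integral_sq_le hσ0 (hX k) (hY k) 0 x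
    simpa only [zero_dotProduct, dotProduct_zero, add_zero, zero_add] using h
  have hlogp : Tendsto (fun k => Real.log (p k)) atTop atTop :=
    Real.tendsto_log_atTop.comp (tendsto_natCast_atTop_atTop.comp hp)
  have helllim : Tendsto ell atTop atTop :=
    hlogp.atTop_add_nonneg (fun k => Real.log_natCast_nonneg _)
  intro δ hδ
  have hlim : Tendsto (fun k => ENNReal.ofReal (18 * Real.exp (-ell k))) atTop (𝓝 0) := by
    have h1 : Tendsto (fun k => 18 * Real.exp (-ell k)) atTop (𝓝 (18 * 0)) :=
      (Real.tendsto_exp_neg_atTop_nhds_zero.comp helllim).const_mul 18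
    rw [mul_zero] at h1
    simpa using ENNReal.tendsto_ofReal h1
  refine tendsto_of_tendsto_of_tendsto_of_le_of_le' tendsto_const_nhds hlim
    (Eventually.of_forall fun _ => zero_le) ?_
  have small : ∀ {f : ℕ → ℝ} (_ : Tendsto f atTop (𝓝 0)) (c : ℝ) {b : ℝ} (_ : 0 < b),
      ∀ᶠ k in atTop, c * f k < b := fun hf c b hb => by
    have := hf.const_mul c
    rw [mul_zero] at this
    exact this.eventually_lt_const hb
  filter_upwards [hn.eventually_ge_atTop 1, hp.eventually_ge_atTop 1, hr.eventually_ge_atTop 1, hpn,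
    small hqlim K one_pos, small hqlim K (by positivity : 0 < 24 / a),
    small hmlim (C₁ * K) one_pos, small hmlim (C ^ 2 * (C₁ * K)) one_pos,
    small hmlim (C * (C₁ * K)) (by positivity : 0 < δ ^ 2)] with k hn1 hp1 hr1 hpnk ht1 hta hm1 hm2 hm3
  have hnpos : (0 : ℝ) < n k := by exact_mod_cast hn1
  have hppos : (0 : ℝ) < p k := by exact_mod_cast hp1
  have hsn : 0 < √(n k : ℝ) := Real.sqrt_pos.2 hnpos
  have hell0 : 0 ≤ ell k := add_nonneg (Real.log_natCast_nonneg _) (Real.log_natCast_nonneg _)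
  have ht0 : 0 ≤ K * q k := mul_nonneg hK0.le (hq0 k)
  set g := scoreGap (popU (P k) (X k) (Y k)) (V k) (u k) with hg
  have hgp : 0 < g := hgpos k
  have hρm : τ k ^ 2 * q k ≤ m k := by
    rw [hq, hm]
    simp only
    rw [← mul_div_assoc]
    exact div_le_div_of_nonneg_right (le_max_left _ _) hsn.le
  have hρg : τ k ^ 2 * q k ≤ g ^ 2 * m k := by
    rw [hq, hm]
    simp only
    rw [← mul_div_assoc, ← mul_div_assoc]
    refine div_le_div_of_nonneg_right ?_ hsn.le
    refine le_trans (le_of_eq ?_) (mul_le_mul_of_nonneg_left (le_max_right _ _) (sq_nonneg g))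
    rw [← hg]
    field_simp
  have hρ : τ k ^ 2 * (C₁ * (K * q k)) = C₁ * K * (τ k ^ 2 * q k) := by ring
  have hCK : 0 ≤ C₁ * K := by positivity
  have hρle : τ k ^ 2 * (C₁ * (K * q k)) ≤ C₁ * K * m k := by
    rw [hρ]; exact mul_le_mul_of_nonneg_left hρm hCK
  -- With `ε = C₁ K q`, this is the bound `p ε ≤ κ` for `κ = C₁ K`.
  have hpq : (p k : ℝ) * q k ≤ 1 := by
    rw [hq]
    simp only
    rw [← mul_div_assoc, div_le_one hsn]
    rw [lt_div_iff₀ hppos] at hpnk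
    linarith
  have hprob := measureReal_exists_abs_mean_sub_ge_le (P := P k) (n := n k) hn1
    (hsample k).indep (hsample k).identDistrib ha0
    (ι := Option (Fin (p k) ⊕ Fin (r k)) × Option (Fin (p k) ⊕ Fin (r k)))
    (g := fun c z => pairCoord c.1 z * pairCoord c.2 z)
    (fun c => (measurable_pairCoord c.1).mul (measurable_pairCoord c.2))
    (fun c => (hsubG k).hasExpMoment_mul hσ (hX k) (hY k) c.1 c.2) ht0 hta.le
  have hexp : (n k : ℝ) * a ^ 2 * (K * q k) ^ 2 / 96 = 3 * ell k := by
    have : q k ^ 2 * n k = ell k := by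
      rw [hq]
      simp only
      rw [div_pow, Real.sq_sqrt hell0, Real.sq_sqrt hnpos.le]
      field_simp
    linear_combination (q k ^ 2 * n k / 96) * hKsq + 3 * this
  rw [hexp] at hprob
  have hfinal := hprob.trans (mul_le_mul_of_nonneg_right (card_pairCoord_le hp1 hr1)
    (by positivity))
  have hexp2 : 9 * Real.exp (2 * (Real.log (p k) + Real.log (r k))) *
      (2 * Real.exp (-(3 * ell k))) = 18 * Real.exp (-ell k) := by
    have : Real.exp (-ell k) = Real.exp (2 * ell k) * Real.exp (-(3 * ell k)) := by
      rw [← Real.exp_add]; congr 1; ring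
    rw [this]
    ring
  rw [hexp2] at hfinal
  -- Monotonicity needs no measurability: outside the exceptional event the deterministic bound
  -- holds for every admissible estimate.
  refine (measure_mono ?_).trans (ENNReal.le_ofReal_iff_toReal_le (measure_ne_top _ _)
    (by positivity) |>.2 hfinal)
  intro ω hω
  rw [Set.mem_ofPred_eq] at hω ⊢
  by_contra hno
  push Not at hno
  obtain ⟨e1, e2⟩ := herr k hn1 ω (K * q k) ht0 ht1.le fun c c' => (hno (c, c')).le
  have hres := hbound (covMatrix_isHermitian (P k) (Y k)) (covMatrix (P k) (X k) (Y k)) (hV k)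
    (hgap k) (covMatrix_self_quadratic_nonneg (hY2 k))
    (covMatrix_mulVec_sq_le (hY2 k) (hY2 k) hL0 (hYL k) (hYL k))
    (covMatrix_mulVec_sq_le (hX2 k) (hY2 k) hL0 (hXL k) (hYL k)) (hE k ▸ henv k) (hu k)
    (hE k ▸ hdim k) (hτ k) (by positivity) e1 e2
    (by
      have := mul_le_mul_of_nonneg_left hpq hCK
      linarith)
    (hρle.trans hm1.le)
    (by
      rw [← hpopU, ← hg]
      -- Squaring turns the score condition into one on `ρ / Δ_U²`, which is why the gap enters the
      -- rate with power `-2`.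
      refine lt_of_pow_lt_pow_left₀ 2 hgp.le ?_
      rw [mul_pow, Real.sq_sqrt (by positivity), hρ]
      have h1 := mul_le_mul_of_nonneg_left hρg (by positivity : 0 ≤ C ^ 2 * (C₁ * K))
      have h2 := mul_lt_mul_of_pos_left hm2 (by positivity : 0 < g ^ 2)
      linarith)
    (hEhat k ω)
  rw [← hE] at hres
  have h1 := mul_le_mul_of_nonneg_left hρle hC
  have h2 := pow_le_pow_left₀ hδ.le hω 2
  linarith

end Consistency

/-! ### The corollary for centred and for raw observations -/

theorem corollary2
    -- sample size, numbers of predictors and responses, along an arbitrary sequence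
    (n p r : ℕ → ℕ)
    (hn : Tendsto n atTop atTop) (hp : Tendsto p atTop atTop) (hr : Tendsto r atTop atTop)
    -- the linear model, jointly sub-Gaussian with a common parameter
    {Ω : ℕ → Type*} [∀ k, MeasurableSpace (Ω k)]
    (P : ∀ k, Measure (Ω k)) [∀ k, IsProbabilityMeasure (P k)]
    (α : ∀ k, Fin (r k) → ℝ) (β : ∀ k, Matrix (Fin (r k)) (Fin (p k)) ℝ)
    (X : ∀ k, Ω k → Fin (p k) → ℝ) (Y ε : ∀ k, Ω k → Fin (r k) → ℝ)
    (hmodel : ∀ k, IsLinearModel (P k) (α k) (β k) (X k) (Y k) (ε k))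
    (σ : ℝ) (hσ : 0 < σ) (hsubG : ∀ k, IsJointSubGaussian (P k) σ (X k) (Y k))
    -- the sample
    (Xs : ∀ k, Fin (n k) → Ω k → Fin (p k) → ℝ) (Ys : ∀ k, Fin (n k) → Ω k → Fin (r k) → ℝ)
    (hsample : ∀ k, IsIIDSample (P k) (X k) (Y k) (Xs k) (Ys k))
    -- the first `d` eigenvectors of the covariance matrix of the response, separated eigenvalues
    (d : ℕ) (V : ∀ k, Fin d → Fin (r k) → ℝ)
    (hV : ∀ k, IsLeadingEigenvectors (covMatrix_isHermitian (P k) (Y k)) (V k))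
    (Δ : ℝ) (hΔ : 0 < Δ)
    (hgap : ∀ k, ∀ j < d,
      Δ ≤ sortedEigenvalue (covMatrix_isHermitian (P k) (Y k)) j -
        sortedEigenvalue (covMatrix_isHermitian (P k) (Y k)) (j + 1))
    -- the envelope lies in their span and has dimension `u k`
    (henv : ∀ k, responseEnvelope (P k) (X k) (Y k) ≤ Submodule.span ℝ (Set.range (V k)))
    (u : ℕ → ℕ) (hu : ∀ k, 1 ≤ u k)
    (hdim : ∀ k, Module.finrank ℝ (responseEnvelope (P k) (X k) (Y k)) = u k)
    -- the tuning parameter exceeds the sparsity level of the eigenvectors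
    (τ : ℕ → ℝ) (hτ : ∀ k j, l1Norm (V k j) < τ k)
    -- the growth conditions
    (hlog : (fun k => √(Real.log (p k) + Real.log (r k))) =o[atTop] fun k => √(n k : ℝ))
    (hpn : ∀ᶠ k in atTop, √(Real.log (p k) + Real.log (r k)) < √(n k : ℝ) / (p k : ℝ))
    (hrate : (fun k => max (τ k ^ 2 * √(Real.log (p k) + Real.log (r k)))
        ((scoreGap (popU (P k) (X k) (Y k)) (V k) (u k) ^ 2)⁻¹ * τ k ^ 2 *
          √(Real.log (p k) + Real.log (r k)))) =o[atTop] fun k => √(n k : ℝ)) :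
    -- the estimator from centred observations is consistent
    (∀ Ehat : ∀ k, Ω k → Submodule ℝ (Fin (r k) → ℝ),
      (∀ k ω, IsSparseNIECE (centredRows (dataMatrix (Xs k) ω))
        (centredRows (dataMatrix (Ys k) ω)) (τ k) d (u k) (Ehat k ω)) →
      SubspaceConsistent P (fun k => responseEnvelope (P k) (X k) (Y k)) Ehat) ∧
    -- if the variables have mean zero, so is the estimator from the raw observations
    ((∀ k, (∀ i, ∫ ω, X k ω i ∂(P k) = 0) ∧ ∀ j, ∫ ω, Y k ω j ∂(P k) = 0) →
      ∀ Ehat : ∀ k, Ω k → Submodule ℝ (Fin (r k) → ℝ),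
      (∀ k ω, IsSparseNIECE (dataMatrix (Xs k) ω) (dataMatrix (Ys k) ω) (τ k) d (u k)
        (Ehat k ω)) →
      SubspaceConsistent P (fun k => responseEnvelope (P k) (X k) (Y k)) Ehat) := by
  have hX : ∀ k, AEMeasurable (X k) (P k) := fun k => (hmodel k).aemeasurable_predictor
  have hY : ∀ k, AEMeasurable (Y k) (P k) := fun k => by
    have h : Measurable fun x : Fin (p k) → ℝ => β k *ᵥ x :=
      (LinearMap.continuous_of_finiteDimensional (β k).mulVecLin).measurable
    have hY' : Y k = fun ω => α k + β k *ᵥ X k ω + ε k ω := funext (hmodel k).equation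
    rw [hY']
    exact ((h.comp_aemeasurable (hX k)).const_add (α k)).add (hmodel k).aemeasurable_error
  -- Enlarging `σ` weakens the tail bound harmlessly and lets the constant coordinate satisfy the
  -- same exponential moment bound.
  have hσ1 : 1 ≤ max σ 1 := le_max_right _ _
  have hG : ∀ k, IsJointSubGaussian (P k) (max σ 1) (X k) (Y k) := fun k =>
    (hsubG k).mono hσ (le_max_left _ _)
  have hC : 0 ≤ 2 + 2 * (3 / (1 / (2 * max σ 1 ^ 2))) := by positivity
  refine ⟨fun Ehat hEhat => ?_, fun hmean Ehat hEhat => ?_⟩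
  · refine subspaceConsistent_of_sample_error hn hp hr hX hY hσ1 hG hsample hV hΔ hgap henv hu
      hdim (fun k j => (hτ k j).le) hlog hpn hrate hC (fun k hnk ω t ht0 ht1 hz => ?_) hEhat
    have key := (hG k).abs_sample_sub_cov_le hσ1 (hX k) (hY k) hnk ht1 hz
    exact ⟨fun i j => key (some (Sum.inr i)) (some (Sum.inr j)),
      fun i j => key (some (Sum.inl i)) (some (Sum.inr j))⟩
  · refine subspaceConsistent_of_sample_error hn hp hr hX hY hσ1 hG hsample hV hΔ hgap henv hu
      hdim (fun k j => (hτ k j).le) hlog hpn hrate hC (fun k hnk ω t ht0 ht1 hz => ?_) hEhat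
    have key := (hG k).abs_raw_sub_cov_le hσ1 (hX k) (hY k) ht0 hz
    exact ⟨fun i j => key (some (Sum.inr i)) (some (Sum.inr j)) ((hmean k).2 i),
      fun i j => key (some (Sum.inl i)) (some (Sum.inr j)) ((hmean k).1 i)⟩
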